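/- **Theorem (Forward type-preservation of the CPS transformation).** All syntax is up to renaming of bound variables. *Parameters.* Fix base types $B$ including $\mathsf{bool}$, primitive values $p$ including $\mathsf{true},\mathsf{false}$, operation names $\mathsf{op}$, and a logic with interpreted terms $t ::= x \mid p \mid f(\tilde t)$, predicates $A ::= X \mid \top \mid {=_B} \mid \omega(\tilde\phi)$ ($X$ a predicate variable, $\omega$ ranging over arbitrary interpreted, possibly variable-binding, predicate-forming operators, which subsume connectives, quantifiers, relation symbols, predicate abstractions and fixpoints) and formulas $\phi ::= A(\tilde t)$. $\Gamma\models\phi\Rightarrow\psi$ denotes semantic validity: $\psi$ holds in every valuation that satisfies $\phi$ and the refinements and formulas of $\Gamma$ (predicate variables range over all relations of their arity; variables of non-refinement type impose no condition). Every primitive value $p$ has a closed well-formed source value type $\mathrm{ty}(p)$, a refinement type over its base type or a function type. *Source types.* $T ::= \{x{:}B\mid\phi\} \mid (x{:}T)\to C$; $C ::= \Sigma\triangleright T/S$; $\Sigma ::= \{\mathsf{op}_i : \forall \widetilde{X_i{:}\tilde B_i}.F_i\}_i$ (finite); $F ::= (x{:}T_1)\to((y{:}T_2)\to C_1)\to C_2$;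 $S ::= \square \mid (\forall x.C_1)\Rightarrow C_2$. Contexts $\Gamma$ list bindings $x{:}T$, $X{:}\tilde B$ and hypotheses $\phi$. $\vdash\Gamma$, $\Gamma\vdash T$, etc. mean that all formulas are well-sorted in scope; $x$ has type $T$ in the scope of $C$, resp. $C_1$, in $(x{:}T)\to C$, resp. $\Sigma\triangleright T/(\forall x.C_1)\Rightarrow C_2$. *Source subtyping.* $\Gamma\vdash\{x{:}B|\phi_1\}<:\{x{:}B|\phi_2\}$ if $\Gamma,x{:}B\models\phi_1\Rightarrow\phi_2$; $(x{:}T_1)\to C_1<:(x{:}T_2)\to C_2$ if $\Gamma\vdash T_2<:T_1$ and $\Gamma,x{:}T_2\vdash C_1<:C_2$ (and likewise for the types $F$); $\Sigma_1<:\Sigma_2$ if each $\mathsf{op}:\forall\widetilde{X{:}\tilde B}.F_2$ in $\Sigma_2$ has $\mathsf{op}:\forall\widetilde{X{:}\tilde B}.F_1$ in $\Sigma_1$ with $\Gamma,\widetilde{X{:}\tilde B}\vdash F_1<:F_2$; $\Sigma_1\triangleright T_1/S_1<:\Sigma_2\triangleright T_2/S_2$ if $\Sigma_2<:\Sigma_1$,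 $T_1<:T_2$ and $\Gamma\mid T_1\vdash S_1<:S_2$. Here $\Gamma\mid T\vdash\square<:\square$; $(\forall x.C_{11})\Rightarrow C_{12}<:(\forall x.C_{21})\Rightarrow C_{22}$ if $\Gamma,x{:}T\vdash C_{21}<:C_{11}$ and $\Gamma\vdash C_{12}<:C_{22}$; $\square<:(\forall x.C_1)\Rightarrow C_2$ if $\Gamma,x{:}T\vdash C_1<:C_2$ with $x$ not free in $C_2$. *Source expressions* (type-annotated). $v ::= x \mid p \mid \mathsf{rec}(f^{T_f},x^{T_x}).c$; $c ::= \mathsf{return}\,v^T \mid (\mathsf{op}^{\tilde A}\,v)^{C} \mid v_1\,v_2 \mid (\mathsf{if}\ v\ \mathsf{then}\ c_1\ \mathsf{else}\ c_2)^C \mid \mathsf{let}\ x=c_1^{C_1}\ \mathsf{in}\ c_2^{C_2} \mid (\mathsf{with}\ h\ \mathsf{handle}\ c)^C$; $h=\{\mathsf{return}\ x_r^{T_r}\mapsto c_r,\ (\mathsf{op}_i^{\widetilde{X_i{:}\tilde B_i}}(x_i^{T_{x_i}},k_i^{T_{k_i}})\mapsto c_i)_i\}$. In a $\mathsf{let}$,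 the annotations $C_1,C_2$ have the shapes displayed in the $\mathsf{let}$ rules below. *Source typing*; annotations must be the types occurring in the rule. - A variable with $\Gamma(x)=\{z{:}B|\phi\}$ has type $\{z{:}B|z=x\}$; any other variable has type $\Gamma(x)$; $p$ has type $\mathrm{ty}(p)$ (each if $\vdash\Gamma$). - $\mathsf{rec}(f,x).c:(x{:}T)\to C$ if $\Gamma,f{:}(x{:}T)\to C,x{:}T\vdash c:C$. - Subsumption for values and computations, when the supertype is well-formed in $\Gamma$. - $\mathsf{return}\,v:\emptyset\triangleright T/\square$ if $v:T$. $v_1\,v_2:C[v_2/x]$ if $v_1:(x{:}T)\to C$ and $v_2:T$. - $\mathsf{if}$ has type $C$ if $v:\{x{:}\mathsf{bool}|\phi\}$, $\Gamma,v=\mathsf{true}\vdash c_1:C$ and $\Gamma,v=\mathsf{false}\vdash c_2:C$. - $\mathsf{let}$ has type $\Sigma\triangleright T_2/\square$ if $c_1:\Sigma\triangleright T_1/\square$ and $\Gamma,x{:}T_1\vdash c_2:\Sigma\triangleright T_2/\square$; it has type $\Sigma\triangleright T_2/(\forall y.C_{21})\Rightarrow C_{12}$ if $c_1:\Sigma\triangleright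 T_1/(\forall x.C)\Rightarrow C_{12}$ and $\Gamma,x{:}T_1\vdash c_2:\Sigma\triangleright T_2/(\forall y.C_{21})\Rightarrow C$; $x$ is not free in $\Sigma,T_2$, nor in $C_{21}$. - If $\Sigma\ni\mathsf{op}:\forall\widetilde{X{:}\tilde B}.(x{:}T_1)\to((y{:}T_2)\to C_1)\to C_2$, $\Gamma\vdash\Sigma$, $\widetilde{\Gamma\vdash A:\tilde B}$ and $v:T_1[\widetilde{A/X}]$, then $\mathsf{op}^{\tilde A}\,v:\Sigma\triangleright T_2\theta/((\forall y.C_1)\Rightarrow C_2)\theta$, where $\theta=[\widetilde{A/X}][v/x]$. - $\mathsf{with}\ h\ \mathsf{handle}\ c:C_2$ if $c:\Sigma\triangleright T/(\forall x_r.C_1)\Rightarrow C_2$, $\Gamma,x_r{:}T\vdash c_r:C_1$, $\Sigma=\{\mathsf{op}_i:\forall\widetilde{X_i{:}\tilde B_i}.(x_i{:}T_{1i})\to((y_i{:}T_{2i})\to C_{1i})\to C_{2i}\}_i$ for the same operations as in $h$, and $\Gamma,\widetilde{X_i{:}\tilde B_i},x_i{:}T_{1i},k_i{:}(y_i{:}T_{2i})\to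 C_{1i}\vdash c_i:C_{2i}$ for all $i$. *Target language* (no effects). $\tau ::= \{x{:}B|\phi\}\mid(x{:}\tau_1)\to\tau_2\mid\forall\widetilde{X{:}\tilde B}.\tau\mid\{\mathsf{op}_i:\tau_i\}_i\mid\alpha\mid\forall\alpha.\tau$; $v ::= x\mid p\mid\mathsf{rec}(f{:}\tau_1,x{:}\tau_2).c\mid\lambda x{:}\tau.c\mid\Lambda\widetilde{X{:}\tilde B}.c\mid\{\mathsf{op}_i=v_i\}_i\mid\Lambda\alpha.c$; $c ::= v\mid c\,v\mid\mathsf{if}\ v\ \mathsf{then}\ c_1\ \mathsf{else}\ c_2\mid c\,\tilde A\mid v\#\mathsf{op}\mid c\,\tau\mid(c:\tau)$. Abstractions over, and applications to, types and values are marked static or dynamic (ignored by typing). Contexts also bind type variables. Rules for variables, $\mathsf{rec}$, application, $\mathsf{if}$ and subsumption are as in the source; $p$ has type $[\![\mathrm{ty}(p)]\!]$; the rules for $\lambda$, predicate and type abstraction and application, records, projection and ascription are the standard ones. Subtyping is as in the source for refinement and function types, componentwise for $\forall\widetilde{X{:}\tilde B}.\tau$, by width and depth for records, reflexive on $\alpha$,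 and $\Gamma\vdash\forall\alpha.\tau_1<:\forall\beta.\tau_2$ if $\Gamma,\beta\vdash\tau_1[\tau/\alpha]<:\tau_2$ for some $\tau$ with $\Gamma,\beta\vdash\tau$, where $\beta$ is not free in $\forall\alpha.\tau_1$. *Transformation of types.* $[\![\{x{:}B|\phi\}]\!]=\{x{:}B|\phi\}$; $[\![(x{:}T)\to C]\!]=(x{:}[\![T]\!])\to[\![C]\!]$; $[\![\Sigma\triangleright T/\square]\!]=\forall\alpha.[\![\Sigma]\!]\to([\![T]\!]\to\alpha)\to\alpha$; $[\![\Sigma\triangleright T/(\forall x.C_1)\Rightarrow C_2]\!]=\forall\_.[\![\Sigma]\!]\to((x{:}[\![T]\!])\to[\![C_1]\!])\to[\![C_2]\!]$; $[\![\{\mathsf{op}_i:\forall\widetilde{X_i{:}\tilde B_i}.(x{:}T_1)\to((y{:}T_2)\to C_1)\to C_2\}_i]\!]=\{\mathsf{op}_i:\forall\widetilde{X_i{:}\tilde B_i}.(x{:}[\![T_1]\!])\to((y{:}[\![T_2]\!])\to[\![C_1]\!])\to[\![C_2]\!]\}_i$. Contexts are transformed entrywise. *Transformation of expressions* (with $\alpha,h,k$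 fresh). $[\![x]\!]=x$, $[\![p]\!]=p$, $[\![\mathsf{rec}(f^{T_f},x^{T_x}).c]\!]=\mathsf{rec}(f{:}[\![T_f]\!],x{:}[\![T_x]\!]).[\![c]\!]$, $[\![v_1\,v_2]\!]=[\![v_1]\!]\,[\![v_2]\!]$; $[\![\mathsf{return}\,v^T]\!]=\Lambda\alpha.\lambda h{:}\{\}.\lambda k{:}[\![T]\!]\to\alpha.\ k\,[\![v]\!]$; $[\![(\mathsf{op}^{\tilde A}v)^{\Sigma\triangleright T/(\forall y.C_1)\Rightarrow C_2}]\!]=\Lambda\alpha.\lambda h{:}[\![\Sigma]\!].\lambda k{:}((y{:}[\![T]\!])\to[\![C_1]\!]).\ h\#\mathsf{op}\ \tilde A\ [\![v]\!]\ (\lambda y'{:}[\![T]\!].\,k\,y')$; $[\![(\mathsf{if}\ v\ \mathsf{then}\ c_1\ \mathsf{else}\ c_2)^C]\!]=(\mathsf{if}\ [\![v]\!]\ \mathsf{then}\ [\![c_1]\!]\ \mathsf{else}\ [\![c_2]\!] : [\![C]\!])$; a $\mathsf{let}$ with pure annotations goes to $\Lambda\alpha.\lambda h{:}[\![\Sigma]\!].\lambda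 k{:}[\![T_2]\!]\to\alpha.\ [\![c_1]\!]\,\alpha\,h\,(\lambda x{:}[\![T_1]\!].[\![c_2]\!]\,\alpha\,h\,k)$; a $\mathsf{let}$ with impure annotations goes to $\Lambda\alpha.\lambda h{:}[\![\Sigma]\!].\lambda k{:}((y{:}[\![T_2]\!])\to[\![C_{21}]\!]).\ [\![c_1]\!]\,[\![C_{12}]\!]\,h\,(\lambda x{:}[\![T_1]\!].[\![c_2]\!]\,[\![C]\!]\,h\,k)$; $[\![(\mathsf{with}\ h\ \mathsf{handle}\ c)^C]\!]=[\![c]\!]\,[\![C]\!]\,\{\mathsf{op}_i=\Lambda\widetilde{X_i{:}\tilde B_i}.\lambda x_i{:}[\![T_{x_i}]\!].\lambda k_i{:}[\![T_{k_i}]\!].[\![c_i]\!]\}_i\,(\lambda x_r{:}[\![T_r]\!].[\![c_r]\!])$. *Claim.* (1) If $\Gamma\vdash v:T$, then $[\![\Gamma]\!]\vdash[\![v]\!]:[\![T]\!]$. (2) If $\Gamma\vdash c:C$, then $[\![\Gamma]\!]\vdash[\![c]\!]:[\![C]\!]$. -/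

import Mathlib

/-!
A refinement type system with answer refinement modification for algebraic effects and handlers,
a polymorphic target calculus without handlers, and the CPS transformation between them.

Binding is represented by de Bruijn indices, with three independent index spaces: term variables,
predicate variables and (in the target calculus only) type variables.
Index `0` is the innermost binding of its kind.  Finite families indexed by operation names
(signatures, handlers, records, record types) are functions on a `Finset` of names, so they are
equal up to permutation of their components.
-/

universe u

namespace ARM

/-! ### Parameters of the calculus: base types, primitive values, operation names, and the logic -/

/-- The parameters: base types, primitive values, operation names, and an interpreted logic.

The logic has terms `x | p | f(t, …, t)`, predicates `X | ⊤ | (=) | ω(φ, …, φ)` and formulas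
`A(t, …, t)`.  The symbols `ω` are arbitrary interpreted predicate-forming operators: `ω` takes
`opArgs ω` formulas, binds in the `i`-th one predicate variables of arities `opBindP ω i` and term
variables of sorts `opBindT ω i`, and yields a predicate of arity `opRes ω`.  Connectives,
first- and second-order quantifiers, interpreted relation symbols, predicate abstractions
`λ x. φ` and fixpoint operators are all of this shape. -/
structure Params where
  /-- base types -/
  Base : Type u
  /-- primitive values -/
  Prim : Type u
  /-- operation names -/
  Op : Type u
  /-- the base type of Booleans -/
  bool : Base
  /-- the primitive value `true` -/
  tt : Prim
  /-- the primitive value `false` -/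
  ff : Prim
  /-- the base type of a first-order primitive value; `none` for a functional one -/
  primSort : Prim → Option Base
  primSort_tt : primSort tt = some bool
  primSort_ff : primSort ff = some bool
  /-- function symbols -/
  Fn : Type u
  fnArity : Fn → ℕ
  fnDom : (f : Fn) → Fin (fnArity f) → Base
  fnCod : Fn → Base
  /-- predicate-forming operators -/
  POp : Type u
  opArgs : POp → ℕ
  opBindP : (w : POp) → Fin (opArgs w) → List (List Base)
  opBindT : (w : POp) → Fin (opArgs w) → List Base
  opRes : POp → List Base
  /-- the first-order individuals, each of a sort -/
  U : Type u
  sortOf : U → Base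
  primVal : Prim → U
  primVal_sort : ∀ p b, primSort p = some b → sortOf (primVal p) = b
  tt_ne_ff : primVal tt ≠ primVal ff
  bool_cases : ∀ a, sortOf a = bool → a = primVal tt ∨ a = primVal ff
  fnVal : (f : Fn) → (Fin (fnArity f) → U) → U
  fnVal_sort : ∀ f a, (∀ i, sortOf (a i) = fnDom f i) → sortOf (fnVal f a) = fnCod f
  /-- the meaning of an operator, as a function of the meanings of its formula arguments, which
  depend on the values of the variables bound in them -/
  opVal : (w : POp) →
    ((i : Fin (opArgs w)) → (Fin (opBindP w i).length → (List U → Prop)) →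
      (Fin (opBindT w i).length → U) → Prop) → List U → Prop

/-! ### Terms, predicates and formulas -/

/-- Logical terms.  `fnv` is what a variable is replaced by when a value that is not first-order
is substituted for it in a type.  It has no sort: as formulas only mention first-order
variables, it never arises in a well-formed type. -/
inductive Tm (P : Params.{u}) : Type u
  | var (x : ℕ)
  | prim (p : P.Prim)
  | fn (f : P.Fn) (args : Fin (P.fnArity f) → Tm P)
  | fnv

/-- Predicates.  The `i`-th formula argument of `op w hd ar` is `(hd i)(ar i)`. -/
inductive Pred (P : Params.{u}) : Type u
  | var (X : ℕ)
  | top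
  | eq (b : P.Base)
  | op (w : P.POp) (hd : Fin (P.opArgs w) → Pred P) (ar : Fin (P.opArgs w) → List (Tm P))

/-- Formulas `A(t, …, t)`. -/
structure Fml (P : Params.{u}) : Type u where
  pred : Pred P
  args : List (Tm P)

variable {P : Params.{u}}

/-- Lift a renaming under `n` binders. -/
def liftR (n : ℕ) (r : ℕ → ℕ) : ℕ → ℕ := fun i => if i < n then i else r (i - n) + n

def Tm.ren (r : ℕ → ℕ) : Tm P → Tm P
  | .var x => .var (r x)
  | .prim p => .prim p
  | .fn f args => .fn f (fun i => (args i).ren r)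
  | .fnv => .fnv

def Tm.subst (s : ℕ → Tm P) : Tm P → Tm P
  | .var x => s x
  | .prim p => .prim p
  | .fn f args => .fn f (fun i => (args i).subst s)
  | .fnv => .fnv

/-- Lift a term substitution under `n` term binders. -/
def liftT (n : ℕ) (s : ℕ → Tm P) : ℕ → Tm P :=
  fun i => if i < n then .var i else (s (i - n)).ren (· + n)

/-- Rename the term variables by `r` and the predicate variables by `q`. -/
def Pred.ren (r q : ℕ → ℕ) : Pred P → Pred P
  | .var X => .var (q X)
  | .top => .top
  | .eq b => .eq b
  | .op w hd ar => .op w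
      (fun i => (hd i).ren (liftR (P.opBindT w i).length r) (liftR (P.opBindP w i).length q))
      (fun i => (ar i).map (Tm.ren (liftR (P.opBindT w i).length r)))

/-- Lift a predicate substitution under `n` term binders and `m` predicate binders. -/
def liftP (n m : ℕ) (t : ℕ → Pred P) : ℕ → Pred P :=
  fun i => if i < m then .var i else (t (i - m)).ren (· + n) (· + m)

/-- Simultaneous capture-avoiding substitution of terms and predicates. -/
def Pred.subst (s : ℕ → Tm P) (t : ℕ → Pred P) : Pred P → Pred P
  | .var X => t X
  | .top => .top
  | .eq b => .eq b
  | .op w hd ar => .op w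
      (fun i => (hd i).subst (liftT (P.opBindT w i).length s)
        (liftP (P.opBindT w i).length (P.opBindP w i).length t))
      (fun i => (ar i).map (Tm.subst (liftT (P.opBindT w i).length s)))

def Fml.ren (r q : ℕ → ℕ) (φ : Fml P) : Fml P := ⟨φ.pred.ren r q, φ.args.map (Tm.ren r)⟩

def Fml.subst (s : ℕ → Tm P) (t : ℕ → Pred P) (φ : Fml P) : Fml P :=
  ⟨φ.pred.subst s t, φ.args.map (Tm.subst s)⟩

/-- The formula `⊤`. -/
def Fml.top : Fml P := ⟨.top, []⟩

/-- The formula `a = b` at base type `B`. -/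
def Fml.eq (B : P.Base) (a b : Tm P) : Fml P := ⟨.eq B, [a, b]⟩

/-- The term substitution replacing index `0` by `a`. -/
def inst (a : Tm P) : ℕ → Tm P
  | 0 => a
  | x + 1 => .var x

/-- The predicate substitution replacing the indices below `As.length` by the entries of `As`. -/
def instP (As : List (Pred P)) : ℕ → Pred P :=
  fun i => if h : i < As.length then As[i] else .var (i - As.length)

/-! ### Sorting of terms, predicates and formulas -/

/-- Extend an assignment of sorts or arities by a list. -/
def extL {α : Type u} (l : List α) (f : ℕ → Option α) : ℕ → Option α :=
  fun i => if h : i < l.length then some l[i] else f (i - l.length)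

/-- `t` is a term of base type `b`; `s` gives the base types of the first-order variables. -/
def Tm.HasSort (s : ℕ → Option P.Base) : Tm P → P.Base → Prop
  | .var x, b => s x = some b
  | .prim p, b => P.primSort p = some b
  | .fn f args, b => b = P.fnCod f ∧ ∀ i, (args i).HasSort s (P.fnDom f i)
  | .fnv, _ => False

/-- `A` is a predicate on tuples of sorts `Bs`; `a` gives the arities of predicate variables. -/
def Pred.HasArity (s : ℕ → Option P.Base) (a : ℕ → Option (List P.Base)) :
    Pred P → List P.Base → Prop
  | .var X, Bs => a X = some Bs
  | .top, Bs => Bs = []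
  | .eq b, Bs => Bs = [b, b]
  | .op w hd ar, Bs => Bs = P.opRes w ∧ ∀ i, ∃ Bi,
      (hd i).HasArity (extL (P.opBindT w i) s) (extL (P.opBindP w i) a) Bi ∧
      List.Forall₂ (Tm.HasSort (extL (P.opBindT w i) s)) (ar i) Bi

def Fml.WF (s : ℕ → Option P.Base) (a : ℕ → Option (List P.Base)) (φ : Fml P) : Prop :=
  ∃ Bs, φ.pred.HasArity s a Bs ∧ List.Forall₂ (Tm.HasSort s) φ.args Bs

/-! ### Semantics of terms, predicates and formulas -/

/-- Extend a valuation by a tuple. -/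
def extV {α : Type u} {n : ℕ} (v : Fin n → α) (f : ℕ → α) : ℕ → α :=
  fun i => if h : i < n then v ⟨i, h⟩ else f (i - n)

def Tm.eval (e : ℕ → P.U) : Tm P → P.U
  | .var x => e x
  | .prim p => P.primVal p
  | .fn f args => P.fnVal f (fun i => (args i).eval e)
  | .fnv => P.primVal P.tt

def Pred.eval (e : ℕ → P.U) (g : ℕ → List P.U → Prop) : Pred P → List P.U → Prop
  | .var X => g X
  | .top => fun _ => True
  | .eq _ => fun l => ∃ a, l = [a, a]
  | .op w hd ar => P.opVal w (fun i R v =>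
      (hd i).eval (extV v e) (extV R g) ((ar i).map (Tm.eval (extV v e))))

def Fml.Holds (e : ℕ → P.U) (g : ℕ → List P.U → Prop) (φ : Fml P) : Prop :=
  φ.pred.eval e g (φ.args.map (Tm.eval e))

/-! ### Source types -/

mutual
/-- Value types `{x : B | φ}` (`φ` under `x`) and `(x : T) → C` (`C` under `x`). -/
inductive VTy (P : Params.{u}) : Type u
  | rfn (B : P.Base) (φ : Fml P)
  | arr (T : VTy P) (C : CTy P)
/-- Computation types `Σ ▷ T / S`. -/
inductive CTy (P : Params.{u}) : Type u
  | mk (Sg : OSig P) (T : VTy P) (S : Eff P)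
/-- Operation signatures: finite maps from operation names to type schemes. -/
inductive OSig (P : Params.{u}) : Type u
  | mk (D : Finset P.Op) (F : {o // o ∈ D} → Scheme P)
/-- Type schemes `∀ X₀ : B₀, …. (x : T₁) → ((y : T₂) → C₁) → C₂`.  All four types are under the
predicate variables (`Xᵢ` is index `i`), `T₂` and `C₂` are also under `x`, and `C₁` is under
`x` and `y`. -/
inductive Scheme (P : Params.{u}) : Type u
  | mk (Bs : List (List P.Base)) (T₁ T₂ : VTy P) (C₁ C₂ : CTy P)
/-- Control effects: pure `□`, and impure `(∀ x. C₁) ⇒ C₂` with `C₁` under `x`. -/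
inductive Eff (P : Params.{u}) : Type u
  | pure
  | imp (C₁ C₂ : CTy P)
end

mutual
def VTy.ren (r q : ℕ → ℕ) : VTy P → VTy P
  | .rfn B φ => .rfn B (φ.ren (liftR 1 r) q)
  | .arr T C => .arr (T.ren r q) (C.ren (liftR 1 r) q)
def CTy.ren (r q : ℕ → ℕ) : CTy P → CTy P
  | .mk Sg T S => .mk (Sg.ren r q) (T.ren r q) (S.ren r q)
def OSig.ren (r q : ℕ → ℕ) : OSig P → OSig P
  | .mk D F => .mk D (fun o => (F o).ren r q)
def Scheme.ren (r q : ℕ → ℕ) : Scheme P → Scheme P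
  | .mk Bs T₁ T₂ C₁ C₂ => .mk Bs
      (T₁.ren r (liftR Bs.length q))
      (T₂.ren (liftR 1 r) (liftR Bs.length q))
      (C₁.ren (liftR 2 r) (liftR Bs.length q))
      (C₂.ren (liftR 1 r) (liftR Bs.length q))
def Eff.ren (r q : ℕ → ℕ) : Eff P → Eff P
  | .pure => .pure
  | .imp C₁ C₂ => .imp (C₁.ren (liftR 1 r) q) (C₂.ren r q)
end

mutual
def VTy.subst (s : ℕ → Tm P) (t : ℕ → Pred P) : VTy P → VTy P
  | .rfn B φ => .rfn B (φ.subst (liftT 1 s) (liftP 1 0 t))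
  | .arr T C => .arr (T.subst s t) (C.subst (liftT 1 s) (liftP 1 0 t))
def CTy.subst (s : ℕ → Tm P) (t : ℕ → Pred P) : CTy P → CTy P
  | .mk Sg T S => .mk (Sg.subst s t) (T.subst s t) (S.subst s t)
def OSig.subst (s : ℕ → Tm P) (t : ℕ → Pred P) : OSig P → OSig P
  | .mk D F => .mk D (fun o => (F o).subst s t)
def Scheme.subst (s : ℕ → Tm P) (t : ℕ → Pred P) : Scheme P → Scheme P
  | .mk Bs T₁ T₂ C₁ C₂ => .mk Bs
      (T₁.subst s (liftP 0 Bs.length t))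
      (T₂.subst (liftT 1 s) (liftP 1 Bs.length t))
      (C₁.subst (liftT 2 s) (liftP 2 Bs.length t))
      (C₂.subst (liftT 1 s) (liftP 1 Bs.length t))
def Eff.subst (s : ℕ → Tm P) (t : ℕ → Pred P) : Eff P → Eff P
  | .pure => .pure
  | .imp C₁ C₂ => .imp (C₁.subst (liftT 1 s) (liftP 1 0 t)) (C₂.subst s t)
end

/-- Weakening by one term variable. -/
abbrev VTy.wk (T : VTy P) : VTy P := T.ren (· + 1) id
abbrev CTy.wk (C : CTy P) : CTy P := C.ren (· + 1) id
abbrev OSig.wk (S : OSig P) : OSig P := S.ren (· + 1) id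

/-! ### Source typing contexts -/

/-- Context entries `x : T`, `X : Bs` and hypotheses `φ`.  The latter render contexts `Γ, φ`,
which stand for `Γ, x : {z : B | φ}` with `x` and `z` fresh; the fresh variable is never
referred to, so it is given no index. -/
inductive Entry (P : Params.{u}) : Type u
  | var (T : VTy P)
  | pred (Bs : List P.Base)
  | hyp (φ : Fml P)

/-- Typing contexts; the head of the list is the most recent entry. -/
abbrev Ctx (P : Params.{u}) : Type u := List (Entry P)

/-- `Γ, X₀ : B₀, …` with `Xᵢ` at index `i`. -/
def Ctx.addP (Γ : Ctx P) (Bs : List (List P.Base)) : Ctx P := Bs.map Entry.pred ++ Γ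

/-- `Γ(x)`, as a type over the whole of `Γ`. -/
def Ctx.lookup : Ctx P → ℕ → Option (VTy P)
  | [], _ => none
  | .var T :: _, 0 => some T.wk
  | .var _ :: Γ, x + 1 => (Ctx.lookup Γ x).map VTy.wk
  | .pred _ :: Γ, x => (Ctx.lookup Γ x).map (VTy.ren id (· + 1))
  | .hyp _ :: Γ, x => Ctx.lookup Γ x

/-- The base types of the variables of refinement type. -/
def Ctx.sorts : Ctx P → ℕ → Option P.Base
  | [], _ => none
  | .var (.rfn B _) :: _, 0 => some B
  | .var (.arr _ _) :: _, 0 => none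
  | .var _ :: Γ, x + 1 => Ctx.sorts Γ x
  | .pred _ :: Γ, x => Ctx.sorts Γ x
  | .hyp _ :: Γ, x => Ctx.sorts Γ x

/-- The arities of the predicate variables. -/
def Ctx.arities : Ctx P → ℕ → Option (List P.Base)
  | [], _ => none
  | .var _ :: Γ, X => Ctx.arities Γ X
  | .pred Bs :: _, 0 => some Bs
  | .pred _ :: Γ, X + 1 => Ctx.arities Γ X
  | .hyp _ :: Γ, X => Ctx.arities Γ X

/-- The valuation `(e, g)` of term and predicate variables satisfies `Γ`.  Variables of
function type are unconstrained; predicate variables range over all relations of their arity. -/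
def Ctx.Models : Ctx P → (ℕ → P.U) → (ℕ → List P.U → Prop) → Prop
  | [], _, _ => True
  | .var (.rfn B φ) :: Γ, e, g =>
      P.sortOf (e 0) = B ∧ φ.Holds e g ∧ Ctx.Models Γ (fun i => e (i + 1)) g
  | .var (.arr _ _) :: Γ, e, g => Ctx.Models Γ (fun i => e (i + 1)) g
  | .pred Bs :: Γ, e, g =>
      (∀ l, g 0 l → l.map P.sortOf = Bs) ∧ Ctx.Models Γ e (fun i => g (i + 1))
  | .hyp φ :: Γ, e, g => φ.Holds e g ∧ Ctx.Models Γ e g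

/-- `Γ ⊨ φ ⇒ ψ`: semantic validity. -/
def Ctx.Entails (Γ : Ctx P) (φ ψ : Fml P) : Prop :=
  ∀ e g, Γ.Models e g → φ.Holds e g → ψ.Holds e g

/-! ### Well-formedness of source types and contexts -/

/-- `Γ ⊢ φ` -/
def Ctx.FmlWF (Γ : Ctx P) (φ : Fml P) : Prop := φ.WF Γ.sorts Γ.arities

/-- `Γ ⊢ A : Bs` -/
def Ctx.PredWF (Γ : Ctx P) (A : Pred P) (Bs : List P.Base) : Prop :=
  A.HasArity Γ.sorts Γ.arities Bs

mutual
/-- `Γ ⊢ T` -/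
def VTy.WF : VTy P → Ctx P → Prop
  | .rfn B φ, Γ => Ctx.FmlWF (.var (.rfn B .top) :: Γ) φ
  | .arr T C, Γ => T.WF Γ ∧ C.WF (.var T :: Γ)
/-- `Γ ⊢ C` -/
def CTy.WF : CTy P → Ctx P → Prop
  | .mk Sg T S, Γ => Sg.WF Γ ∧ T.WF Γ ∧ S.WF T Γ
/-- `Γ ⊢ Σ` -/
def OSig.WF : OSig P → Ctx P → Prop
  | .mk _ F, Γ => ∀ o, (F o).WF Γ
/-- Well-formedness of `∀ X₀ : B₀, …. (x : T₁) → ((y : T₂) → C₁) → C₂`. -/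
def Scheme.WF : Scheme P → Ctx P → Prop
  | .mk Bs T₁ T₂ C₁ C₂, Γ => T₁.WF (Γ.addP Bs) ∧ T₂.WF (.var T₁ :: Γ.addP Bs) ∧
      C₁.WF (.var T₂ :: .var T₁ :: Γ.addP Bs) ∧ C₂.WF (.var T₁ :: Γ.addP Bs)
/-- `Γ | T ⊢ S` -/
def Eff.WF : Eff P → VTy P → Ctx P → Prop
  | .pure, _, _ => True
  | .imp C₁ C₂, T, Γ => C₁.WF (.var T :: Γ) ∧ C₂.WF Γ
end

/-- `⊢ Γ` -/
def Ctx.WF : Ctx P → Prop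
  | [] => True
  | .var T :: Γ => Ctx.WF Γ ∧ T.WF Γ
  | .pred _ :: Γ => Ctx.WF Γ
  | .hyp φ :: Γ => Ctx.WF Γ ∧ Ctx.FmlWF Γ φ

/-- An assignment of closed value types to the primitive values: refinement types over their own
base type to the first-order ones, and function types to the functional ones. -/
structure PrimTyping (P : Params.{u}) where
  ty : P.Prim → VTy P
  wf : ∀ p, (ty p).WF []
  base : ∀ p B, P.primSort p = some B → ∃ φ, ty p = .rfn B φ
  func : ∀ p, P.primSort p = none → ∃ T C, ty p = .arr T C

/-! ### Source subtyping -/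

mutual
/-- `Γ ⊢ T₁ <: T₂` -/
inductive VSub : Ctx P → VTy P → VTy P → Prop
  | rfn {Γ B φ₁ φ₂} : Ctx.Entails (.var (.rfn B .top) :: Γ) φ₁ φ₂ →
      VSub Γ (.rfn B φ₁) (.rfn B φ₂)
  | arr {Γ T₁ T₂ C₁ C₂} : VSub Γ T₂ T₁ → CSub (.var T₂ :: Γ) C₁ C₂ →
      VSub Γ (.arr T₁ C₁) (.arr T₂ C₂)
/-- `Γ ⊢ C₁ <: C₂` -/
inductive CSub : Ctx P → CTy P → CTy P → Prop
  | mk {Γ Sg₁ Sg₂ T₁ T₂ S₁ S₂} : OSub Γ Sg₂ Sg₁ → VSub Γ T₁ T₂ → ESub Γ T₁ S₁ S₂ →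
      CSub Γ (.mk Sg₁ T₁ S₁) (.mk Sg₂ T₂ S₂)
/-- `Γ ⊢ Σ₁ <: Σ₂` -/
inductive OSub : Ctx P → OSig P → OSig P → Prop
  | mk {Γ D₁ D₂ F₁ F₂} (h : D₂ ⊆ D₁) :
      (∀ o (ho : o ∈ D₂), SSub Γ (F₁ ⟨o, h ho⟩) (F₂ ⟨o, ho⟩)) →
      OSub Γ (.mk D₁ F₁) (.mk D₂ F₂)
/-- Subtyping of type schemes: subtyping of function types under the predicate variables. -/
inductive SSub : Ctx P → Scheme P → Scheme P → Prop
  | mk {Γ : Ctx P} {Bs T₁ T₂ C₁ C₂ T₁' T₂' C₁' C₂'} :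
      VSub (Γ.addP Bs) T₁' T₁ →
      VSub (.var T₁' :: Γ.addP Bs) (.arr T₂' C₁') (.arr T₂ C₁) →
      CSub (.var T₁' :: Γ.addP Bs) C₂ C₂' →
      SSub Γ (.mk Bs T₁ T₂ C₁ C₂) (.mk Bs T₁' T₂' C₁' C₂')
/-- `Γ | T ⊢ S₁ <: S₂` -/
inductive ESub : Ctx P → VTy P → Eff P → Eff P → Prop
  | pure {Γ T} : ESub Γ T .pure .pure
  | imp {Γ T C₁₁ C₁₂ C₂₁ C₂₂} : CSub (.var T :: Γ) C₂₁ C₁₁ → CSub Γ C₁₂ C₂₂ →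
      ESub Γ T (.imp C₁₁ C₁₂) (.imp C₂₁ C₂₂)
  | embed {Γ T C₁ C₂} : CSub (.var T :: Γ) C₁ C₂.wk → ESub Γ T .pure (.imp C₁ C₂)
end

/-! ### Source expressions, with the type annotations that the transformation uses -/

mutual
/-- Values.  `fix Tf Tx c` is `rec(f^Tf, x^Tx). c`; in `c`, `x` is index `0` and `f` index `1`. -/
inductive Val (P : Params.{u}) : Type u
  | var (x : ℕ)
  | prim (p : P.Prim)
  | fix (Tf Tx : VTy P) (c : Cmp P)
/-- Computations.
* `ret T v` is `return v^T`;
* `op o As v Sg T C₁ C₂` is `(o^As v)^(Σ ▷ T / (∀ y. C₁) ⇒ C₂)`, with `C₁` under `y`;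
* `ite v c₁ c₂ C` is `(if v then c₁ else c₂)^C`;
* `letP Sg T₁ T₂ c₁ c₂` is `let x = c₁^(Σ ▷ T₁ / □) in c₂^(Σ ▷ T₂ / □)`;
* `letI Sg T₁ T₂ C C₁₂ C₂₁ c₁ c₂` is
  `let x = c₁^(Σ ▷ T₁ / (∀ x. C) ⇒ C₁₂) in c₂^(Σ ▷ T₂ / (∀ y. C₂₁) ⇒ C)`;
  here `C` is under `x` and `C₂₁` is under `y`, while `Σ` and `T₂` are not under `x`
  and neither is `C₂₁`;
* `handle h c C` is `(with h handle c)^C`. -/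
inductive Cmp (P : Params.{u}) : Type u
  | ret (T : VTy P) (v : Val P)
  | op (o : P.Op) (As : List (Pred P)) (v : Val P)
      (Sg : OSig P) (T : VTy P) (C₁ C₂ : CTy P)
  | app (v₁ v₂ : Val P)
  | ite (v : Val P) (c₁ c₂ : Cmp P) (C : CTy P)
  | letP (Sg : OSig P) (T₁ T₂ : VTy P) (c₁ c₂ : Cmp P)
  | letI (Sg : OSig P) (T₁ T₂ : VTy P) (C C₁₂ C₂₁ : CTy P) (c₁ c₂ : Cmp P)
  | handle (h : Hnd P) (c : Cmp P) (C : CTy P)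
/-- Handlers `{return x^Tr ↦ cr, (o^(X : Bs o) (x^(Tx o), k^(Tk o)) ↦ cl o) for o ∈ D}`.
In `cl o`, `k` is index `0`, `x` is index `1`; `Tx o` is under the predicate variables and
`Tk o` is under the predicate variables and `x`. -/
inductive Hnd (P : Params.{u}) : Type u
  | mk (Tr : VTy P) (cr : Cmp P) (D : Finset P.Op) (Bs : {o // o ∈ D} → List (List P.Base))
      (Tx Tk : {o // o ∈ D} → VTy P) (cl : {o // o ∈ D} → Cmp P)
end

/-- The term that represents a value in types. -/
def Val.tm : Val P → Tm P
  | .var x => .var x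
  | .prim p => .prim p
  | .fix _ _ _ => .fnv

/-! ### Source typing -/

mutual
/-- `Γ ⊢ v : T` -/
inductive VTyped (K : PrimTyping P) : Ctx P → Val P → VTy P → Prop
  | cvar {Γ x B φ} : Γ.WF → Γ.lookup x = some (.rfn B φ) →
      VTyped K Γ (.var x) (.rfn B (.eq B (.var 0) (.var (x + 1))))
  | var {Γ x T} : Γ.WF → Γ.lookup x = some T → (∀ B φ, T ≠ .rfn B φ) → VTyped K Γ (.var x) T
  | prim {Γ p} : Γ.WF → VTyped K Γ (.prim p) (K.ty p)
  | fix {Γ T C c} :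
      CTyped K (.var T.wk :: .var (.arr T C) :: Γ) c (C.ren (liftR 1 (· + 1)) id) →
      VTyped K Γ (.fix (.arr T C) T c) (.arr T C)
  | sub {Γ v T₁ T₂} : VTyped K Γ v T₁ → VSub Γ T₁ T₂ → T₂.WF Γ → VTyped K Γ v T₂
/-- `Γ ⊢ c : C` -/
inductive CTyped (K : PrimTyping P) : Ctx P → Cmp P → CTy P → Prop
  | ret {Γ v T} : VTyped K Γ v T →
      CTyped K Γ (.ret T v) (.mk (.mk ∅ (fun o => absurd o.2 (Finset.notMem_empty _))) T .pure)
  | app {Γ v₁ v₂ T C} : VTyped K Γ v₁ (.arr T C) → VTyped K Γ v₂ T →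
      CTyped K Γ (.app v₁ v₂) (C.subst (inst v₂.tm) .var)
  | ite {Γ v c₁ c₂ φ C} : VTyped K Γ v (.rfn P.bool φ) →
      CTyped K (.hyp (.eq P.bool v.tm (.prim P.tt)) :: Γ) c₁ C →
      CTyped K (.hyp (.eq P.bool v.tm (.prim P.ff)) :: Γ) c₂ C →
      CTyped K Γ (.ite v c₁ c₂ C) C
  | sub {Γ c C₁ C₂} : CTyped K Γ c C₁ → CSub Γ C₁ C₂ → C₂.WF Γ → CTyped K Γ c C₂
  | letP {Γ Sg T₁ T₂ c₁ c₂} : CTyped K Γ c₁ (.mk Sg T₁ .pure) →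
      CTyped K (.var T₁ :: Γ) c₂ (.mk Sg.wk T₂.wk .pure) →
      CTyped K Γ (.letP Sg T₁ T₂ c₁ c₂) (.mk Sg T₂ .pure)
  | letI {Γ Sg T₁ T₂ C C₁₂ C₂₁ c₁ c₂} : CTyped K Γ c₁ (.mk Sg T₁ (.imp C C₁₂)) →
      CTyped K (.var T₁ :: Γ) c₂ (.mk Sg.wk T₂.wk (.imp (C₂₁.ren (liftR 1 (· + 1)) id) C)) →
      CTyped K Γ (.letI Sg T₁ T₂ C C₁₂ C₂₁ c₁ c₂) (.mk Sg T₂ (.imp C₂₁ C₁₂))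
  | op {Γ D} {F : {o // o ∈ D} → Scheme P} {o As v Bs T₁ T₂ C₁ C₂ T C₁' C₂'} (ho : o ∈ D) :
      F ⟨o, ho⟩ = .mk Bs T₁ T₂ C₁ C₂ →
      (OSig.mk D F).WF Γ →
      List.Forall₂ (Ctx.PredWF Γ) As Bs →
      VTyped K Γ v (T₁.subst .var (instP As)) →
      T = T₂.subst (inst v.tm) (instP As) →
      Eff.imp C₁' C₂' = (Eff.imp C₁ C₂).subst (inst v.tm) (instP As) →
      CTyped K Γ (.op o As v (.mk D F) T C₁' C₂') (.mk (.mk D F) T (.imp C₁' C₂'))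
  | handle {Γ c T C₁ C₂ cr D Bs} {Tx T₂ : {o // o ∈ D} → VTy P} {D₁ D₂ : {o // o ∈ D} → CTy P}
      {cl} :
      CTyped K Γ c
        (.mk (.mk D (fun o => .mk (Bs o) (Tx o) (T₂ o) (D₁ o) (D₂ o))) T (.imp C₁ C₂)) →
      CTyped K (.var T :: Γ) cr C₁ →
      (∀ o, CTyped K (.var (.arr (T₂ o) (D₁ o)) :: .var (Tx o) :: Γ.addP (Bs o)) (cl o)
        (D₂ o).wk) →
      CTyped K Γ (.handle (.mk T cr D Bs Tx (fun o => .arr (T₂ o) (D₁ o)) cl) c C₂) C₂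
end

/-! ### Target types -/

/-- Target types `{x : B | φ}`, `(x : τ₁) → τ₂`, `∀ X : Bs. τ`, record types, type variables and
`∀ α. τ`. -/
inductive TTy (P : Params.{u}) : Type u
  | rfn (B : P.Base) (φ : Fml P)
  | arr (τ₁ τ₂ : TTy P)
  | allP (Bs : List (List P.Base)) (τ : TTy P)
  | rcd (D : Finset P.Op) (F : {o // o ∈ D} → TTy P)
  | tvar (a : ℕ)
  | all (τ : TTy P)

/-- Rename the term, predicate and type variables by `r`, `q` and `z`. -/
def TTy.ren : (r q z : ℕ → ℕ) → TTy P → TTy P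
  | r, q, _, .rfn B φ => .rfn B (φ.ren (liftR 1 r) q)
  | r, q, z, .arr τ₁ τ₂ => .arr (τ₁.ren r q z) (τ₂.ren (liftR 1 r) q z)
  | r, q, z, .allP Bs τ => .allP Bs (τ.ren r (liftR Bs.length q) z)
  | r, q, z, .rcd D F => .rcd D (fun o => (F o).ren r q z)
  | _, _, z, .tvar a => .tvar (z a)
  | r, q, z, .all τ => .all (τ.ren r q (liftR 1 z))

/-- Lift a type substitution under `n` term, `m` predicate and `k` type binders. -/
def liftY (n m k : ℕ) (y : ℕ → TTy P) : ℕ → TTy P :=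
  fun i => if i < k then .tvar i else (y (i - k)).ren (· + n) (· + m) (· + k)

/-- Simultaneous substitution of terms, predicates and types. -/
def TTy.subst : (s : ℕ → Tm P) → (t : ℕ → Pred P) → (y : ℕ → TTy P) → TTy P → TTy P
  | s, t, _, .rfn B φ => .rfn B (φ.subst (liftT 1 s) (liftP 1 0 t))
  | s, t, y, .arr τ₁ τ₂ =>
      .arr (τ₁.subst s t y) (τ₂.subst (liftT 1 s) (liftP 1 0 t) (liftY 1 0 0 y))
  | s, t, y, .allP Bs τ =>
      .allP Bs (τ.subst s (liftP 0 Bs.length t) (liftY 0 Bs.length 0 y))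
  | s, t, y, .rcd D F => .rcd D (fun o => (F o).subst s t y)
  | _, _, y, .tvar a => y a
  | s, t, y, .all τ => .all (τ.subst s t (liftY 0 0 1 y))

/-- The type substitution replacing index `0` by `σ`. -/
def instY (σ : TTy P) : ℕ → TTy P
  | 0 => σ
  | a + 1 => .tvar a

/-- Weakening by one term variable. -/
abbrev TTy.wk (τ : TTy P) : TTy P := τ.ren (· + 1) id id

/-! ### Target typing contexts -/

inductive TEntry (P : Params.{u}) : Type u
  | var (τ : TTy P)
  | pred (Bs : List P.Base)
  | hyp (φ : Fml P)
  | ty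

abbrev TCtx (P : Params.{u}) : Type u := List (TEntry P)

def TCtx.addP (Γ : TCtx P) (Bs : List (List P.Base)) : TCtx P := Bs.map TEntry.pred ++ Γ

def TCtx.lookup : TCtx P → ℕ → Option (TTy P)
  | [], _ => none
  | .var τ :: _, 0 => some τ.wk
  | .var _ :: Γ, x + 1 => (TCtx.lookup Γ x).map TTy.wk
  | .pred _ :: Γ, x => (TCtx.lookup Γ x).map (TTy.ren id (· + 1) id)
  | .hyp _ :: Γ, x => TCtx.lookup Γ x
  | .ty :: Γ, x => (TCtx.lookup Γ x).map (TTy.ren id id (· + 1))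

/-- The base type of a refinement type. -/
def TTy.sort : TTy P → Option P.Base
  | .rfn B _ => some B
  | _ => none

def TCtx.sorts : TCtx P → ℕ → Option P.Base
  | [], _ => none
  | .var τ :: _, 0 => τ.sort
  | .var _ :: Γ, x + 1 => TCtx.sorts Γ x
  | .pred _ :: Γ, x => TCtx.sorts Γ x
  | .hyp _ :: Γ, x => TCtx.sorts Γ x
  | .ty :: Γ, x => TCtx.sorts Γ x

def TCtx.arities : TCtx P → ℕ → Option (List P.Base)
  | [], _ => none
  | .var _ :: Γ, X => TCtx.arities Γ X
  | .pred Bs :: _, 0 => some Bs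
  | .pred _ :: Γ, X + 1 => TCtx.arities Γ X
  | .hyp _ :: Γ, X => TCtx.arities Γ X
  | .ty :: Γ, X => TCtx.arities Γ X

/-- The number of type variables. -/
def TCtx.tys : TCtx P → ℕ
  | [] => 0
  | .ty :: Γ => TCtx.tys Γ + 1
  | _ :: Γ => TCtx.tys Γ

/-- What a binding `x : τ` says about the value `e 0` of `x`; only refinement types constrain it. -/
def TTy.Sat (e : ℕ → P.U) (g : ℕ → List P.U → Prop) : TTy P → Prop
  | .rfn B φ => P.sortOf (e 0) = B ∧ φ.Holds e g
  | _ => True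

def TCtx.Models : TCtx P → (ℕ → P.U) → (ℕ → List P.U → Prop) → Prop
  | [], _, _ => True
  | .var τ :: Γ, e, g => τ.Sat e g ∧ TCtx.Models Γ (fun i => e (i + 1)) g
  | .pred Bs :: Γ, e, g =>
      (∀ l, g 0 l → l.map P.sortOf = Bs) ∧ TCtx.Models Γ e (fun i => g (i + 1))
  | .hyp φ :: Γ, e, g => φ.Holds e g ∧ TCtx.Models Γ e g
  | .ty :: Γ, e, g => TCtx.Models Γ e g

def TCtx.Entails (Γ : TCtx P) (φ ψ : Fml P) : Prop :=
  ∀ e g, Γ.Models e g → φ.Holds e g → ψ.Holds e g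

def TCtx.FmlWF (Γ : TCtx P) (φ : Fml P) : Prop := φ.WF Γ.sorts Γ.arities

def TCtx.PredWF (Γ : TCtx P) (A : Pred P) (Bs : List P.Base) : Prop :=
  A.HasArity Γ.sorts Γ.arities Bs

/-- `Γ ⊢ τ` -/
def TTy.WF : TTy P → TCtx P → Prop
  | .rfn B φ, Γ => TCtx.FmlWF (.var (.rfn B .top) :: Γ) φ
  | .arr τ₁ τ₂, Γ => τ₁.WF Γ ∧ τ₂.WF (.var τ₁ :: Γ)
  | .allP Bs τ, Γ => τ.WF (Γ.addP Bs)
  | .rcd _ F, Γ => ∀ o, (F o).WF Γ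
  | .tvar a, Γ => a < Γ.tys
  | .all τ, Γ => τ.WF (.ty :: Γ)

/-- `⊢ Γ` -/
def TCtx.WF : TCtx P → Prop
  | [] => True
  | .var τ :: Γ => TCtx.WF Γ ∧ τ.WF Γ
  | .pred _ :: Γ => TCtx.WF Γ
  | .hyp φ :: Γ => TCtx.WF Γ ∧ TCtx.FmlWF Γ φ
  | .ty :: Γ => TCtx.WF Γ

/-! ### Target subtyping -/

/-- `Γ ⊢ τ₁ <: τ₂`.  In the rule for `∀ α. τ₁ <: ∀ β. τ₂`, the context is extended with `β`
(index `0`), `α` is instantiated with a type `σ` that may mention `β`, and the other type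
variables of `τ₁` are weakened past `β`. -/
inductive TSub : TCtx P → TTy P → TTy P → Prop
  | rfn {Γ B φ₁ φ₂} : TCtx.Entails (.var (.rfn B .top) :: Γ) φ₁ φ₂ →
      TSub Γ (.rfn B φ₁) (.rfn B φ₂)
  | arr {Γ τ₁ τ₂ τ₁' τ₂'} : TSub Γ τ₁' τ₁ → TSub (.var τ₁' :: Γ) τ₂ τ₂' →
      TSub Γ (.arr τ₁ τ₂) (.arr τ₁' τ₂')
  | allP {Γ : TCtx P} {Bs τ₁ τ₂} : TSub (Γ.addP Bs) τ₁ τ₂ → TSub Γ (.allP Bs τ₁) (.allP Bs τ₂)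
  | rcd {Γ D₁ D₂ F₁ F₂} (h : D₂ ⊆ D₁) :
      (∀ o (ho : o ∈ D₂), TSub Γ (F₁ ⟨o, h ho⟩) (F₂ ⟨o, ho⟩)) →
      TSub Γ (.rcd D₁ F₁) (.rcd D₂ F₂)
  | tvar {Γ a} : TSub Γ (.tvar a) (.tvar a)
  | all {Γ τ₁ τ₂ σ} : σ.WF (.ty :: Γ) →
      TSub (.ty :: Γ)
        (τ₁.subst .var .var (fun a => match a with | 0 => σ | a + 1 => .tvar (a + 1))) τ₂ →
      TSub Γ (.all τ₁) (.all τ₂)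

/-! ### Target expressions -/

/-- Abstractions and applications are marked as static (introduced by the transformation and
reduced at transformation time) or dynamic.  Typing ignores the mark. -/
inductive Phase
  | st
  | dy

mutual
/-- Target values: variables, primitive values, `rec(f : τ₁, x : τ₂). c` (`x` is index `0`, `f`
index `1`), `λ x : τ. c` (the abbreviation of the former when `f` does not occur in `c`),
`Λ X : Bs. c`, records, and `Λ α. c`. -/
inductive TVal (P : Params.{u}) : Type u
  | var (x : ℕ)
  | prim (p : P.Prim)
  | fix (τ₁ τ₂ : TTy P) (c : TExp P)
  | lam (m : Phase) (τ : TTy P) (c : TExp P)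
  | plam (Bs : List (List P.Base)) (c : TExp P)
  | rcd (D : Finset P.Op) (F : {o // o ∈ D} → TVal P)
  | tlam (m : Phase) (c : TExp P)
/-- Target expressions: values, `c v`, conditionals, `c As`, `v#o`, `c τ` and `(c : τ)`. -/
inductive TExp (P : Params.{u}) : Type u
  | val (v : TVal P)
  | app (m : Phase) (c : TExp P) (v : TVal P)
  | ite (v : TVal P) (c₁ c₂ : TExp P)
  | papp (c : TExp P) (As : List (Pred P))
  | proj (v : TVal P) (o : P.Op)
  | tapp (m : Phase) (c : TExp P) (τ : TTy P)
  | asc (c : TExp P) (τ : TTy P)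
end

mutual
def TVal.ren : (r q z : ℕ → ℕ) → TVal P → TVal P
  | r, _, _, .var x => .var (r x)
  | _, _, _, .prim p => .prim p
  | r, q, z, .fix τ₁ τ₂ c => .fix (τ₁.ren r q z) (τ₂.ren r q z) (c.ren (liftR 2 r) q z)
  | r, q, z, .lam m τ c => .lam m (τ.ren r q z) (c.ren (liftR 1 r) q z)
  | r, q, z, .plam Bs c => .plam Bs (c.ren r (liftR Bs.length q) z)
  | r, q, z, .rcd D F => .rcd D (fun o => (F o).ren r q z)
  | r, q, z, .tlam m c => .tlam m (c.ren r q (liftR 1 z))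
def TExp.ren : (r q z : ℕ → ℕ) → TExp P → TExp P
  | r, q, z, .val v => .val (v.ren r q z)
  | r, q, z, .app m c v => .app m (c.ren r q z) (v.ren r q z)
  | r, q, z, .ite v c₁ c₂ => .ite (v.ren r q z) (c₁.ren r q z) (c₂.ren r q z)
  | r, q, z, .papp c As => .papp (c.ren r q z) (As.map (Pred.ren r q))
  | r, q, z, .proj v o => .proj (v.ren r q z) o
  | r, q, z, .tapp m c τ => .tapp m (c.ren r q z) (τ.ren r q z)
  | r, q, z, .asc c τ => .asc (c.ren r q z) (τ.ren r q z)
end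

def TVal.tm : TVal P → Tm P
  | .var x => .var x
  | .prim p => .prim p
  | _ => .fnv

/-! ### CPS transformation of types and contexts -/

mutual
def VTy.cps : VTy P → TTy P
  | .rfn B φ => .rfn B φ
  | .arr T C => .arr T.cps C.cps
/-- `Σ ▷ T / □` becomes `∀ α. ⟦Σ⟧ → (⟦T⟧ → α) → α`, and `Σ ▷ T / (∀ x. C₁) ⇒ C₂` becomes
`∀ _. ⟦Σ⟧ → ((x : ⟦T⟧) → ⟦C₁⟧) → ⟦C₂⟧`. -/
def CTy.cps : CTy P → TTy P
  | .mk Sg T .pure =>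
      .all (.arr (Sg.cps.ren id id (· + 1))
        (.arr (.arr (T.cps.ren (· + 1) id (· + 1)) (.tvar 0)) (.tvar 0)))
  | .mk Sg T (.imp C₁ C₂) =>
      .all (.arr (Sg.cps.ren id id (· + 1))
        (.arr ((TTy.arr T.cps C₁.cps).ren (· + 1) id (· + 1)) (C₂.cps.ren (· + 2) id (· + 1))))
def OSig.cps : OSig P → TTy P
  | .mk D F => .rcd D (fun o => (F o).cps)
def Scheme.cps : Scheme P → TTy P
  | .mk Bs T₁ T₂ C₁ C₂ => .allP Bs (.arr T₁.cps (.arr (.arr T₂.cps C₁.cps) C₂.cps.wk))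
end

def Entry.cps : Entry P → TEntry P
  | .var T => .var T.cps
  | .pred Bs => .pred Bs
  | .hyp φ => .hyp φ

def Ctx.cps (Γ : Ctx P) : TCtx P := Γ.map Entry.cps

/-! ### Target typing -/

mutual
/-- Typing of target values.  A primitive value has the transform of its source type. -/
inductive TVTyped (K : PrimTyping P) : TCtx P → TVal P → TTy P → Prop
  | cvar {Γ x B φ} : Γ.WF → Γ.lookup x = some (.rfn B φ) →
      TVTyped K Γ (.var x) (.rfn B (.eq B (.var 0) (.var (x + 1))))
  | var {Γ x τ} : Γ.WF → Γ.lookup x = some τ → (∀ B φ, τ ≠ .rfn B φ) → TVTyped K Γ (.var x) τ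
  | prim {Γ p} : Γ.WF → TVTyped K Γ (.prim p) (K.ty p).cps
  | fix {Γ τ₁ τ₂ c} :
      TTyped K (.var τ₁.wk :: .var (.arr τ₁ τ₂) :: Γ) c (τ₂.ren (liftR 1 (· + 1)) id id) →
      TVTyped K Γ (.fix (.arr τ₁ τ₂) τ₁ c) (.arr τ₁ τ₂)
  | lam {Γ m τ₁ τ₂ c} : TTyped K (.var τ₁ :: Γ) c τ₂ → TVTyped K Γ (.lam m τ₁ c) (.arr τ₁ τ₂)
  | plam {Γ : TCtx P} {Bs τ c} : TTyped K (Γ.addP Bs) c τ →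
      TVTyped K Γ (.plam Bs c) (.allP Bs τ)
  | rcd {Γ D} {F : {o // o ∈ D} → TVal P} {G : {o // o ∈ D} → TTy P} : Γ.WF →
      (∀ o, TVTyped K Γ (F o) (G o)) → TVTyped K Γ (.rcd D F) (.rcd D G)
  | tlam {Γ m τ c} : TTyped K (.ty :: Γ) c τ → TVTyped K Γ (.tlam m c) (.all τ)
  | sub {Γ v τ₁ τ₂} : TVTyped K Γ v τ₁ → TSub Γ τ₁ τ₂ → τ₂.WF Γ → TVTyped K Γ v τ₂
/-- Typing of target expressions, `Γ ⊢ c : τ`. -/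
inductive TTyped (K : PrimTyping P) : TCtx P → TExp P → TTy P → Prop
  | val {Γ v τ} : TVTyped K Γ v τ → TTyped K Γ (.val v) τ
  | app {Γ m c v τ₁ τ₂} : TTyped K Γ c (.arr τ₁ τ₂) → TVTyped K Γ v τ₁ →
      TTyped K Γ (.app m c v) (τ₂.subst (inst v.tm) .var .tvar)
  | ite {Γ v c₁ c₂ φ τ} : TVTyped K Γ v (.rfn P.bool φ) →
      TTyped K (.hyp (.eq P.bool v.tm (.prim P.tt)) :: Γ) c₁ τ →
      TTyped K (.hyp (.eq P.bool v.tm (.prim P.ff)) :: Γ) c₂ τ →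
      TTyped K Γ (.ite v c₁ c₂) τ
  | papp {Γ c As Bs τ} : TTyped K Γ c (.allP Bs τ) → List.Forall₂ (TCtx.PredWF Γ) As Bs →
      TTyped K Γ (.papp c As) (τ.subst .var (instP As) .tvar)
  | proj {Γ v D} {G : {o // o ∈ D} → TTy P} {o} (ho : o ∈ D) : TVTyped K Γ v (.rcd D G) →
      TTyped K Γ (.proj v o) (G ⟨o, ho⟩)
  | tapp {Γ m c τ σ} : TTyped K Γ c (.all τ) → σ.WF Γ →
      TTyped K Γ (.tapp m c σ) (τ.subst .var .var (instY σ))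
  | asc {Γ c τ} : TTyped K Γ c τ → TTyped K Γ (.asc c τ) τ
  | sub {Γ c τ₁ τ₂} : TTyped K Γ c τ₁ → TSub Γ τ₁ τ₂ → τ₂.WF Γ → TTyped K Γ c τ₂
end

/-! ### CPS transformation of expressions -/

/-- Weakening past the binders `α`, `h`, `k` (one type variable and two term variables). -/
abbrev TTy.up (τ : TTy P) : TTy P := τ.ren (· + 2) id (· + 1)
abbrev TVal.up (v : TVal P) : TVal P := v.ren (· + 2) id (· + 1)
abbrev TExp.up (c : TExp P) : TExp P := c.ren (· + 2) id (· + 1)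

/-- Weakening past `α`, `h`, `k` inserted before the innermost term variable. -/
abbrev TTy.up1 (τ : TTy P) : TTy P := τ.ren (liftR 1 (· + 2)) id (· + 1)
abbrev TExp.up1 (c : TExp P) : TExp P := c.ren (liftR 1 (· + 2)) id (· + 1)

/-- `Λ α. λ h : τh. λ k : τk. c` (static abstractions); `τh` is under `α`, `τk` is under `α` and
`h`, and `c` is under all three. -/
def cpsAbs (τh τk : TTy P) (c : TExp P) : TExp P :=
  .val (.tlam .st (.val (.lam .st τh (.val (.lam .st τk c)))))

/-- `c @ τ @ v₁ @ v₂` (static applications). -/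
def cpsApp (c : TExp P) (τ : TTy P) (v₁ v₂ : TVal P) : TExp P :=
  .app .st (.app .st (.tapp .st c τ) v₁) v₂

mutual
def Val.cps : Val P → TVal P
  | .var x => .var x
  | .prim p => .prim p
  | .fix Tf Tx c => .fix Tf.cps Tx.cps c.cps
/-- * `return v`: `Λ α. λ h : {}. λ k : ⟦T⟧ → α. k ⟦v⟧`
* `op v`: `Λ α. λ h : ⟦Σ⟧. λ k : ((y : ⟦T⟧) → ⟦C₁⟧). h#op As ⟦v⟧ (λ y' : ⟦T⟧. k y')`
* `v₁ v₂`: `⟦v₁⟧ ⟦v₂⟧`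
* `if`: `(if ⟦v⟧ then ⟦c₁⟧ else ⟦c₂⟧ : ⟦C⟧)`
* pure `let`: `Λ α. λ h : ⟦Σ⟧. λ k : ⟦T₂⟧ → α. ⟦c₁⟧ @ α @ h @ (λ x : ⟦T₁⟧. ⟦c₂⟧ @ α @ h @ k)`
* impure `let`: `Λ α. λ h : ⟦Σ⟧. λ k : ((y : ⟦T₂⟧) → ⟦C₂₁⟧).
    ⟦c₁⟧ @ ⟦C₁₂⟧ @ h @ (λ x : ⟦T₁⟧. ⟦c₂⟧ @ ⟦C⟧ @ h @ k)`
* `with h handle c`: `⟦c⟧ @ ⟦C⟧ @ ⟦h^ops⟧ @ ⟦h^ret⟧` -/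
def Cmp.cps : Cmp P → TExp P
  | .ret T v =>
      cpsAbs (.rcd ∅ (fun o => absurd o.2 (Finset.notMem_empty _)))
        (.arr (T.cps.ren (· + 1) id (· + 1)) (.tvar 0))
        (.app .dy (.val (.var 0)) v.cps.up)
  | .op o As v Sg T C₁ _ =>
      cpsAbs (Sg.cps.ren id id (· + 1)) ((TTy.arr T.cps C₁.cps).ren (· + 1) id (· + 1))
        (.app .dy
          (.app .dy (.papp (.proj (.var 1) o) (As.map (Pred.ren (· + 2) id))) v.cps.up)
          (.lam .dy T.cps.up (.app .dy (.val (.var 1)) (.var 0))))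
  | .app v₁ v₂ => .app .dy (.val v₁.cps) v₂.cps
  | .ite v c₁ c₂ C => .asc (.ite v.cps c₁.cps c₂.cps) C.cps
  | .letP Sg T₁ T₂ c₁ c₂ =>
      cpsAbs (Sg.cps.ren id id (· + 1)) (.arr (T₂.cps.ren (· + 1) id (· + 1)) (.tvar 0))
        (cpsApp c₁.cps.up (.tvar 0) (.var 1)
          (.lam .dy T₁.cps.up (cpsApp c₂.cps.up1 (.tvar 0) (.var 2) (.var 1))))
  | .letI Sg T₁ T₂ C C₁₂ C₂₁ c₁ c₂ =>
      cpsAbs (Sg.cps.ren id id (· + 1)) ((TTy.arr T₂.cps C₂₁.cps).ren (· + 1) id (· + 1))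
        (cpsApp c₁.cps.up C₁₂.cps.up (.var 1)
          (.lam .dy T₁.cps.up (cpsApp c₂.cps.up1 C.cps.up1 (.var 2) (.var 1))))
  | .handle h c C => cpsApp c.cps C.cps h.cpsOps h.cpsRet
/-- The record of the transformed operation clauses. -/
def Hnd.cpsOps : Hnd P → TVal P
  | .mk _ _ D Bs Tx Tk cl => .rcd D (fun o =>
      .plam (Bs o) (.val (.lam .dy (Tx o).cps (.val (.lam .dy (Tk o).cps (cl o).cps)))))
/-- The transformed return clause. -/
def Hnd.cpsRet : Hnd P → TVal P
  | .mk Tr cr _ _ _ _ _ => .lam .dy Tr.cps cr.cps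
end

end ARM

namespace ARM
variable {P : Params.{u}} {K : PrimTyping P}

/-! ### The algebra of renamings and substitutions -/

@[simp] theorem liftR_zero (r : ℕ → ℕ) : liftR 0 r = r := by
  funext i; simp [liftR]

@[simp] theorem liftR_id (n : ℕ) : liftR n id = id := by
  funext i; simp only [liftR, id]; split <;> omega

theorem liftR_succ (n : ℕ) (r : ℕ → ℕ) : liftR (n + 1) r = liftR 1 (liftR n r) := by
  funext i
  simp only [liftR]
  rcases i with _ | i
  · simp
  · by_cases h : i < n
    · simp [h]
    · simp only [Nat.add_lt_add_iff_right, h, Nat.add_sub_add_right, if_false]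
      simp [h]; omega

@[simp] theorem liftR_one_zero (r : ℕ → ℕ) : liftR 1 r 0 = 0 := rfl

@[simp] theorem liftR_one_succ (r : ℕ → ℕ) (i : ℕ) : liftR 1 r (i + 1) = r i + 1 := by
  simp [liftR]

theorem liftR_comp (n : ℕ) (r r' : ℕ → ℕ) :
    (fun i => liftR n r' (liftR n r i)) = liftR n (fun i => r' (r i)) := by
  funext i
  by_cases h : i < n <;> simp [liftR, h]

theorem liftR_two (r : ℕ → ℕ) : liftR 2 r = liftR 1 (liftR 1 r) := liftR_succ 1 r

theorem liftR_add (n : ℕ) (r : ℕ → ℕ) (i : ℕ) : liftR n r (i + n) = r i + n := by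
  simp [liftR]

namespace Tm

theorem ren_id (t : Tm P) : t.ren id = t := by
  induction t with
  | fn f args ih => simp only [ren, ih]
  | _ => rfl

theorem ren_ren (r r' : ℕ → ℕ) (t : Tm P) : (t.ren r).ren r' = t.ren (fun i => r' (r i)) := by
  induction t with
  | fn f args ih => simp only [ren, ih]
  | _ => rfl

theorem ren_eq_subst (r : ℕ → ℕ) (t : Tm P) : t.ren r = t.subst (fun i => .var (r i)) := by
  induction t with
  | fn f args ih => simp only [ren, subst, ih]
  | _ => rfl

theorem ren_subst (r : ℕ → ℕ) (s : ℕ → Tm P) (t : Tm P) :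
    (t.ren r).subst s = t.subst (fun i => s (r i)) := by
  induction t with
  | fn f args ih => simp only [ren, subst, ih]
  | _ => rfl

theorem subst_ren (s : ℕ → Tm P) (r : ℕ → ℕ) (t : Tm P) :
    (t.subst s).ren r = t.subst (fun i => (s i).ren r) := by
  induction t with
  | fn f args ih => simp only [ren, subst, ih]
  | _ => rfl

theorem subst_subst (s s' : ℕ → Tm P) (t : Tm P) :
    (t.subst s).subst s' = t.subst (fun i => (s i).subst s') := by
  induction t with
  | fn f args ih => simp only [subst, ih]
  | _ => rfl

theorem subst_var (t : Tm P) : t.subst .var = t := by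
  induction t with
  | fn f args ih => simp only [subst, ih]
  | _ => rfl

end Tm

@[simp] theorem liftT_var (n : ℕ) : liftT n (Tm.var (P := P)) = .var := by
  funext i
  by_cases h : i < n
  · simp [liftT, h]
  · simp only [liftT, h, if_false, Tm.ren]; congr 1; omega

@[simp] theorem liftT_zero (s : ℕ → Tm P) : liftT 0 s = s := by
  funext i
  simp only [liftT]; exact Tm.ren_id (s i)

theorem liftT_ren_var (n : ℕ) (r : ℕ → ℕ) :
    liftT n (fun i => Tm.var (P := P) (r i)) = fun i => .var (liftR n r i) := by
  funext i
  by_cases h : i < n <;> simp [liftT, liftR, h, Tm.ren]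

theorem liftT_liftR (n : ℕ) (r : ℕ → ℕ) (s : ℕ → Tm P) :
    (fun i => liftT n s (liftR n r i)) = liftT n (fun i => s (r i)) := by
  funext i
  by_cases h : i < n <;> simp [liftT, liftR, h]

theorem liftT_ren (n : ℕ) (s : ℕ → Tm P) (r : ℕ → ℕ) :
    (fun i => (liftT n s i).ren (liftR n r)) = liftT n (fun i => (s i).ren r) := by
  funext i
  by_cases h : i < n
  · simp [liftT, liftR, h, Tm.ren]
  · simp [liftT, h, Tm.ren_ren, liftR_add]

theorem liftT_add (n : ℕ) (s : ℕ → Tm P) (i : ℕ) : liftT n s (i + n) = (s i).ren (· + n) := by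
  simp [liftT]

theorem liftT_subst (n : ℕ) (s s' : ℕ → Tm P) :
    (fun i => (liftT n s i).subst (liftT n s')) = liftT n (fun i => (s i).subst s') := by
  funext i
  by_cases h : i < n
  · simp [liftT, h, Tm.subst]
  · simp [liftT, h, Tm.ren_subst, Tm.subst_ren]

@[simp] theorem liftT_one_succ (s : ℕ → Tm P) (i : ℕ) :
    liftT 1 s (i + 1) = (s i).ren (· + 1) := by
  simp [liftT]

namespace Pred

theorem ren_id (A : Pred P) : A.ren id id = A := by
  induction A with
  | op w hd ar ih =>
    simp only [ren, liftR_id, ih]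
    congr
    funext i
    exact (List.map_congr_left fun t _ => Tm.ren_id t).trans (List.map_id _)
  | _ => rfl

/-- The composition laws have to come in the order renaming-renaming, mixed,
substitution-substitution: lifting a substitution under binders renames its values, so the lifting
identity behind a later law uses the earlier ones. -/
theorem ren_ren (r q r' q' : ℕ → ℕ) (A : Pred P) :
    (A.ren r q).ren r' q' = A.ren (fun i => r' (r i)) (fun i => q' (q i)) := by
  induction A generalizing r q r' q' with
  | op w hd ar ih =>
    simp only [ren, ih, liftR_comp, List.map_map, Function.comp_def, Tm.ren_ren]
  | _ => rfl

end Pred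

@[simp] theorem liftP_zero (t : ℕ → Pred P) : liftP 0 0 t = t := by
  funext i
  simp only [liftP]; exact Pred.ren_id (t i)

@[simp] theorem liftP_var (n m : ℕ) : liftP n m (Pred.var (P := P)) = .var := by
  funext i
  by_cases h : i < m
  · simp [liftP, h]
  · simp only [liftP, h, if_false, Pred.ren]; congr 1; omega

theorem liftP_ren_var (n m : ℕ) (q : ℕ → ℕ) :
    liftP n m (fun i => Pred.var (P := P) (q i)) = fun i => .var (liftR m q i) := by
  funext i
  by_cases h : i < m <;> simp [liftP, liftR, h, Pred.ren]

theorem liftP_liftR (n m : ℕ) (q : ℕ → ℕ) (t : ℕ → Pred P) :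
    (fun i => liftP n m t (liftR m q i)) = liftP n m (fun i => t (q i)) := by
  funext i
  by_cases h : i < m <;> simp [liftP, liftR, h]

theorem liftP_add (n m : ℕ) (t : ℕ → Pred P) (i : ℕ) :
    liftP n m t (i + m) = (t i).ren (· + n) (· + m) := by
  simp [liftP]

theorem liftP_ren (n m : ℕ) (t : ℕ → Pred P) (r q : ℕ → ℕ) :
    (fun i => (liftP n m t i).ren (liftR n r) (liftR m q)) =
      liftP n m (fun i => (t i).ren r q) := by
  funext i
  by_cases h : i < m
  · simp [liftP, liftR, h, Pred.ren]
  · simp [liftP, h, Pred.ren_ren, liftR_add]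

theorem liftP_one_apply (t : ℕ → Pred P) (i : ℕ) : liftP 1 0 t i = (t i).ren (· + 1) id := by
  simp only [liftP]; rfl

namespace Pred

theorem ren_eq_subst (r q : ℕ → ℕ) (A : Pred P) :
    A.ren r q = A.subst (fun i => .var (r i)) (fun i => .var (q i)) := by
  induction A generalizing r q with
  | op w hd ar ih =>
    simp only [ren, subst, ih, liftT_ren_var, liftP_ren_var, funext (Tm.ren_eq_subst _)]
  | _ => rfl

theorem ren_subst (r q : ℕ → ℕ) (s : ℕ → Tm P) (t : ℕ → Pred P) (A : Pred P) :
    (A.ren r q).subst s t = A.subst (fun i => s (r i)) (fun i => t (q i)) := by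
  induction A generalizing r q s t with
  | op w hd ar ih =>
    simp only [ren, subst, ih, liftT_liftR, liftP_liftR, List.map_map, Function.comp_def,
      Tm.ren_subst]
  | _ => rfl

theorem subst_ren (s : ℕ → Tm P) (t : ℕ → Pred P) (r q : ℕ → ℕ) (A : Pred P) :
    (A.subst s t).ren r q = A.subst (fun i => (s i).ren r) (fun i => (t i).ren r q) := by
  induction A generalizing r q s t with
  | op w hd ar ih =>
    simp only [ren, subst, ih, liftT_ren, liftP_ren, List.map_map, Function.comp_def,
      Tm.subst_ren]
  | _ => rfl

theorem subst_var (A : Pred P) : A.subst .var .var = A := by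
  induction A with
  | op w hd ar ih =>
    simp only [subst, liftT_var, liftP_var, ih]
    congr
    funext i
    exact (List.map_congr_left fun t _ => Tm.subst_var t).trans (List.map_id _)
  | _ => rfl

end Pred

theorem liftP_subst (n m : ℕ) (t t' : ℕ → Pred P) (s' : ℕ → Tm P) :
    (fun i => (liftP n m t i).subst (liftT n s') (liftP n m t')) =
      liftP n m (fun i => (t i).subst s' t') := by
  funext i
  by_cases h : i < m
  · simp [liftP, h, Pred.subst]
  · simp [liftP, h, Pred.ren_subst, Pred.subst_ren, liftT_add]

namespace Pred

theorem subst_subst (s s' : ℕ → Tm P) (t t' : ℕ → Pred P) (A : Pred P) :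
    (A.subst s t).subst s' t' =
      A.subst (fun i => (s i).subst s') (fun i => (t i).subst s' t') := by
  induction A generalizing s s' t t' with
  | op w hd ar ih =>
    simp only [subst, ih, liftT_subst, liftP_subst, List.map_map, Function.comp_def,
      Tm.subst_subst]
  | _ => rfl

end Pred

namespace Fml

theorem ren_eq_subst (r q : ℕ → ℕ) (φ : Fml P) :
    φ.ren r q = φ.subst (fun i => .var (r i)) (fun i => .var (q i)) := by
  simp only [ren, subst, Pred.ren_eq_subst, funext (Tm.ren_eq_subst _)]

theorem ren_ren (r q r' q' : ℕ → ℕ) (φ : Fml P) :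
    (φ.ren r q).ren r' q' = φ.ren (fun i => r' (r i)) (fun i => q' (q i)) := by
  simp only [ren, Pred.ren_ren, List.map_map, Function.comp_def, Tm.ren_ren]

theorem ren_subst (r q : ℕ → ℕ) (s : ℕ → Tm P) (t : ℕ → Pred P) (φ : Fml P) :
    (φ.ren r q).subst s t = φ.subst (fun i => s (r i)) (fun i => t (q i)) := by
  simp only [ren, subst, Pred.ren_subst, List.map_map, Function.comp_def, Tm.ren_subst]

theorem subst_ren (s : ℕ → Tm P) (t : ℕ → Pred P) (r q : ℕ → ℕ) (φ : Fml P) :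
    (φ.subst s t).ren r q = φ.subst (fun i => (s i).ren r) (fun i => (t i).ren r q) := by
  simp only [ren, subst, Pred.subst_ren, List.map_map, Function.comp_def, Tm.subst_ren]

theorem subst_subst (s s' : ℕ → Tm P) (t t' : ℕ → Pred P) (φ : Fml P) :
    (φ.subst s t).subst s' t' =
      φ.subst (fun i => (s i).subst s') (fun i => (t i).subst s' t') := by
  simp only [subst, Pred.subst_subst, List.map_map, Function.comp_def, Tm.subst_subst]

theorem subst_var (φ : Fml P) : φ.subst .var .var = φ := by
  obtain ⟨A, l⟩ := φ
  simp only [subst, Pred.subst_var]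
  congr
  exact (List.map_congr_left fun t _ => Tm.subst_var t).trans (List.map_id _)

end Fml

-- Composition laws for target types

namespace TTy

theorem ren_ren (r q z r' q' z' : ℕ → ℕ) (τ : TTy P) :
    (τ.ren r q z).ren r' q' z' =
      τ.ren (fun i => r' (r i)) (fun i => q' (q i)) (fun i => z' (z i)) := by
  induction τ generalizing r q z r' q' z' with
  | rfn B φ => simp only [ren, Fml.ren_ren, liftR_comp]
  | arr τ₁ τ₂ ih₁ ih₂ => simp only [ren, ih₁, ih₂, liftR_comp]
  | allP Bs τ ih => simp only [ren, ih, liftR_comp]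
  | rcd D F ih => simp only [ren, ih]
  | tvar a => rfl
  | all τ ih => simp only [ren, ih, liftR_comp]

end TTy

theorem liftY_ren_var (n m k : ℕ) (z : ℕ → ℕ) :
    liftY n m k (fun i => TTy.tvar (P := P) (z i)) = fun i => .tvar (liftR k z i) := by
  funext i
  by_cases h : i < k <;> simp [liftY, liftR, h, TTy.ren]

@[simp] theorem liftY_tvar (n m k : ℕ) : liftY n m k (TTy.tvar (P := P)) = .tvar := by
  funext i
  by_cases h : i < k
  · simp [liftY, h]
  · simp only [liftY, h, if_false, TTy.ren]; congr 1; omega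

theorem liftY_liftR (n m k : ℕ) (z : ℕ → ℕ) (y : ℕ → TTy P) :
    (fun i => liftY n m k y (liftR k z i)) = liftY n m k (fun i => y (z i)) := by
  funext i
  by_cases h : i < k <;> simp [liftY, liftR, h]

theorem liftY_ren (n m k : ℕ) (y : ℕ → TTy P) (r q z : ℕ → ℕ) :
    (fun i => (liftY n m k y i).ren (liftR n r) (liftR m q) (liftR k z)) =
      liftY n m k (fun i => (y i).ren r q z) := by
  funext i
  by_cases h : i < k
  · simp [liftY, liftR, h, TTy.ren]
  · simp [liftY, h, TTy.ren_ren, liftR_add]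

namespace TTy

theorem ren_eq_subst (r q z : ℕ → ℕ) (τ : TTy P) :
    τ.ren r q z = τ.subst (fun i => .var (r i)) (fun i => .var (q i)) (fun i => .tvar (z i)) := by
  induction τ generalizing r q z with
  | rfn B φ => simp only [ren, subst, Fml.ren_eq_subst, liftT_ren_var, liftP_ren_var, liftR_zero]
  | arr τ₁ τ₂ ih₁ ih₂ =>
    simp only [ren, subst, ih₁, ih₂, liftT_ren_var, liftP_ren_var, liftY_ren_var, liftR_zero]
  | allP Bs τ ih => simp only [ren, subst, ih, liftP_ren_var, liftY_ren_var, liftR_zero]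
  | rcd D F ih => simp only [ren, subst, ih]
  | tvar a => rfl
  | all τ ih => simp only [ren, subst, ih, liftY_ren_var]

theorem ren_subst (r q z : ℕ → ℕ) (s : ℕ → Tm P) (t : ℕ → Pred P) (y : ℕ → TTy P) (τ : TTy P) :
    (τ.ren r q z).subst s t y =
      τ.subst (fun i => s (r i)) (fun i => t (q i)) (fun i => y (z i)) := by
  induction τ generalizing r q z s t y with
  | rfn B φ =>
    -- A term binder binds no predicate variables, so `q` is lifted by `0`; the identity is
    -- normalised to contain `q` itself, as in the definition of renaming.
    have h := liftP_liftR 1 0 q t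
    rw [liftR_zero] at h
    simp only [ren, subst, Fml.ren_subst, liftT_liftR, h]
  | arr τ₁ τ₂ ih₁ ih₂ =>
    have h := liftP_liftR 1 0 q t
    have h' := liftY_liftR 1 0 0 z y
    rw [liftR_zero] at h h'
    simp only [ren, subst, ih₁, ih₂, liftT_liftR, h, h']
  | allP Bs τ ih =>
    have h' := liftY_liftR 0 Bs.length 0 z y
    rw [liftR_zero] at h'
    simp only [ren, subst, ih, liftP_liftR, h']
  | rcd D F ih => simp only [ren, subst, ih]
  | tvar a => rfl
  | all τ ih => simp only [ren, subst, ih, liftY_liftR]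

theorem subst_ren (s : ℕ → Tm P) (t : ℕ → Pred P) (y : ℕ → TTy P) (r q z : ℕ → ℕ) (τ : TTy P) :
    (τ.subst s t y).ren r q z =
      τ.subst (fun i => (s i).ren r) (fun i => (t i).ren r q) (fun i => (y i).ren r q z) := by
  induction τ generalizing r q z s t y with
  | rfn B φ =>
    have h := liftP_ren 1 0 t r q
    rw [liftR_zero] at h
    simp only [ren, subst, Fml.subst_ren, liftT_ren, h]
  | arr τ₁ τ₂ ih₁ ih₂ =>
    have h := liftP_ren 1 0 t r q
    have h' := liftY_ren 1 0 0 y r q z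
    rw [liftR_zero] at h h'
    rw [liftR_zero] at h'
    simp only [ren, subst, ih₁, ih₂, liftT_ren, h, h']
  | allP Bs τ ih =>
    have h := liftP_ren 0 Bs.length t r q
    have h' := liftY_ren 0 Bs.length 0 y r q z
    rw [liftR_zero] at h h'
    rw [liftR_zero] at h'
    simp only [ren, subst, ih, h, h']
  | rcd D F ih => simp only [ren, subst, ih]
  | tvar a => rfl
  | all τ ih =>
    have h' := liftY_ren 0 0 1 y r q z
    rw [liftR_zero, liftR_zero] at h'
    simp only [ren, subst, ih, h']

theorem subst_var (τ : TTy P) : τ.subst .var .var .tvar = τ := by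
  induction τ with
  | rfn B φ => simp only [subst, liftT_var, liftP_var, Fml.subst_var]
  | arr τ₁ τ₂ ih₁ ih₂ => simp only [subst, liftT_var, liftP_var, liftY_tvar, ih₁, ih₂]
  | allP Bs τ ih => simp only [subst, liftP_var, liftY_tvar, ih]
  | rcd D F ih => simp only [subst, ih]
  | tvar a => rfl
  | all τ ih => simp only [subst, liftY_tvar, ih]

theorem ren_id (τ : TTy P) : τ.ren id id id = τ := by
  rw [ren_eq_subst]; exact subst_var τ

end TTy

theorem liftY_subst (n m k : ℕ) (y y' : ℕ → TTy P) (s' : ℕ → Tm P) (t' : ℕ → Pred P) :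
    (fun i => (liftY n m k y i).subst (liftT n s') (liftP n m t') (liftY n m k y')) =
      liftY n m k (fun i => (y i).subst s' t' y') := by
  funext i
  by_cases h : i < k
  · simp [liftY, h, TTy.subst]
  · simp [liftY, h, TTy.ren_subst, TTy.subst_ren, liftT_add, liftP_add]

namespace TTy

theorem subst_subst (s s' : ℕ → Tm P) (t t' : ℕ → Pred P) (y y' : ℕ → TTy P) (τ : TTy P) :
    (τ.subst s t y).subst s' t' y' =
      τ.subst (fun i => (s i).subst s') (fun i => (t i).subst s' t')
        (fun i => (y i).subst s' t' y') := by
  induction τ generalizing s s' t t' y y' with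
  | rfn B φ => simp only [subst, Fml.subst_subst, liftT_subst, liftP_subst]
  | arr τ₁ τ₂ ih₁ ih₂ => simp only [subst, ih₁, ih₂, liftT_subst, liftP_subst, liftY_subst]
  | allP Bs τ ih =>
    have h := liftP_subst 0 Bs.length t t' s'
    have h' := liftY_subst 0 Bs.length 0 y y' s' t'
    rw [liftT_zero] at h h'
    simp only [subst, ih, h, h']
  | rcd D F ih => simp only [subst, ih]
  | tvar a => rfl
  | all τ ih =>
    have h' := liftY_subst 0 0 1 y y' s' t'
    rw [liftT_zero, liftP_zero] at h'
    simp only [subst, ih, h']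

end TTy

/-! ### The transformation commutes with renaming and substitution -/

mutual
/-- The transform of a source type has no free type variables, so that `z` is arbitrary. -/
theorem VTy.cps_ren (r q z : ℕ → ℕ) : ∀ T : VTy P, T.cps.ren r q z = (T.ren r q).cps
  | .rfn B φ => rfl
  | .arr T C => by
    simp only [VTy.cps, VTy.ren, TTy.ren, VTy.cps_ren r q z T, CTy.cps_ren (liftR 1 r) q z C]
-- The transform itself contains weakenings past `α`, `h` and `k`. The induction hypotheses are
-- therefore used right to left where such weakenings occur, so that both sides become composite
-- renamings of the same types.
theorem CTy.cps_ren (r q z : ℕ → ℕ) : ∀ C : CTy P, C.cps.ren r q z = (C.ren r q).cps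
  | .mk Sg T .pure => by
    simp only [CTy.cps, CTy.ren, Eff.ren, TTy.ren, ← OSig.cps_ren r q z Sg,
      ← VTy.cps_ren r q z T, TTy.ren_ren, liftR_one_zero, liftR_one_succ, id]
  | .mk Sg T (.imp C₁ C₂) => by
    simp only [CTy.cps, CTy.ren, Eff.ren, TTy.ren, ← OSig.cps_ren r q z Sg,
      ← VTy.cps_ren r q z T, ← CTy.cps_ren (liftR 1 r) q z C₁, ← CTy.cps_ren r q z C₂,
      TTy.ren_ren, liftR_one_succ, liftR_comp, id]
theorem OSig.cps_ren (r q z : ℕ → ℕ) : ∀ Sg : OSig P, Sg.cps.ren r q z = (Sg.ren r q).cps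
  | .mk D F => by
    simp only [OSig.cps, OSig.ren, TTy.ren, fun o => Scheme.cps_ren r q z (F o)]
theorem Scheme.cps_ren (r q z : ℕ → ℕ) : ∀ F : Scheme P, F.cps.ren r q z = (F.ren r q).cps
  | .mk Bs T₁ T₂ C₁ C₂ => by
    simp only [Scheme.cps, Scheme.ren, TTy.ren, VTy.cps_ren _ _ z T₁, VTy.cps_ren _ _ z T₂,
      CTy.cps_ren _ _ z C₁, ← CTy.cps_ren _ _ z C₂, TTy.ren_ren, liftR_one_succ, liftR_two, id]
end

theorem liftT_succ (n : ℕ) (s : ℕ → Tm P) : liftT (n + 1) s = liftT 1 (liftT n s) := by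
  funext i
  rcases i with _ | i
  · simp [liftT]
  · by_cases h : i < n
    · simp [liftT, h, Tm.ren]
    · simp [liftT, h, Tm.ren_ren, Nat.add_assoc]

theorem liftT_two (s : ℕ → Tm P) : liftT 2 s = liftT 1 (liftT 1 s) := liftT_succ 1 s

theorem liftP_one_liftP (n m : ℕ) (t : ℕ → Pred P) :
    liftP 1 0 (liftP n m t) = liftP (n + 1) m t := by
  funext i
  by_cases h : i < m
  · simp [liftP, h, Pred.ren]
  · simp [liftP, h, Pred.ren_ren, Nat.add_assoc]

@[simp] theorem liftY_one_apply (y : ℕ → TTy P) (i : ℕ) :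
    liftY 1 0 0 y i = (y i).ren (· + 1) id id := by
  simp only [liftY]; rfl

@[simp] theorem liftY_zero_one_zero (n m : ℕ) (y : ℕ → TTy P) : liftY n m 1 y 0 = .tvar 0 := rfl

@[simp] theorem liftY_zero_one_succ (y : ℕ → TTy P) (i : ℕ) :
    liftY 0 0 1 y (i + 1) = (y i).ren id id (· + 1) := by
  simp only [liftY]; rfl

mutual
/-- The transform of a source type has no free type variables, so that `y` is arbitrary. -/
theorem VTy.cps_subst (s : ℕ → Tm P) (t : ℕ → Pred P) (y : ℕ → TTy P) :
    ∀ T : VTy P, T.cps.subst s t y = (T.subst s t).cps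
  | .rfn B φ => rfl
  | .arr T C => by
    simp only [VTy.cps, VTy.subst, TTy.subst, VTy.cps_subst s t y T, CTy.cps_subst _ _ _ C]
theorem CTy.cps_subst (s : ℕ → Tm P) (t : ℕ → Pred P) (y : ℕ → TTy P) :
    ∀ C : CTy P, C.cps.subst s t y = (C.subst s t).cps
  | .mk Sg T .pure => by
    simp only [CTy.cps, CTy.subst, Eff.subst, TTy.subst, ← OSig.cps_subst s t y Sg,
      ← VTy.cps_subst s t y T, TTy.ren_subst, TTy.subst_ren, liftT_one_succ, liftP_one_apply,
      liftY_one_apply, liftY_zero_one_zero, liftY_zero_one_succ, TTy.ren_ren, TTy.ren, id,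
      Tm.ren_id, Pred.ren_id]
    rfl
  | .mk Sg T (.imp C₁ C₂) => by
    simp only [CTy.cps, CTy.subst, Eff.subst, TTy.subst, ← OSig.cps_subst s t y Sg,
      ← VTy.cps_subst s t y T, ← CTy.cps_subst (liftT 1 s) (liftP 1 0 t) (liftY 1 0 0 y) C₁,
      ← CTy.cps_subst s t y C₂, TTy.ren_subst, TTy.subst_ren, liftT_one_succ, liftP_one_apply,
      liftY_one_apply, liftY_zero_one_succ, TTy.ren_ren, TTy.ren, id,
      Tm.ren_id, Pred.ren_id, Tm.ren_ren, Pred.ren_ren, liftT_liftR, liftT_ren, liftR_one_succ]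
    rfl
theorem OSig.cps_subst (s : ℕ → Tm P) (t : ℕ → Pred P) (y : ℕ → TTy P) :
    ∀ Sg : OSig P, Sg.cps.subst s t y = (Sg.subst s t).cps
  | .mk D F => by
    simp only [OSig.cps, OSig.subst, TTy.subst, fun o => Scheme.cps_subst s t y (F o)]
theorem Scheme.cps_subst (s : ℕ → Tm P) (t : ℕ → Pred P) (y : ℕ → TTy P) :
    ∀ F : Scheme P, F.cps.subst s t y = (F.subst s t).cps
  | .mk Bs T₁ T₂ C₁ C₂ => by
    -- Used right to left, the commutation for `C₂` leaves its type substitution undetermined; the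
    -- one supplied is the lift that arises on the other side.
    simp only [Scheme.cps, Scheme.subst, TTy.subst, VTy.cps_subst _ _ _ T₁,
      VTy.cps_subst _ _ _ T₂, CTy.cps_subst _ _ _ C₁, ← CTy.cps_subst _ _ (liftY 1 0 0 (liftY 0 Bs.length 0 y)) C₂, liftT_two,
      liftP_one_liftP, TTy.ren_subst, TTy.subst_ren, liftT_one_succ, liftY_one_apply,
      ← liftP_one_apply, id, Nat.zero_add, Nat.reduceAdd]
end

/-! ### Sorting under renaming and substitution -/

/-- `r` maps the domain of `f` to that of `g` and preserves what is assigned. -/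
def Maps {α : Type u} (r : ℕ → ℕ) (f g : ℕ → Option α) : Prop :=
  ∀ i a, f i = some a → g (r i) = some a

/-- What `g` assigns to `r i` is what `f` assigns to `i`. -/
def Reflects {α : Type u} (r : ℕ → ℕ) (f g : ℕ → Option α) : Prop :=
  ∀ i a, g (r i) = some a → f i = some a

/-- `r` fixes the domain of `f`. -/
def Fixes {α : Type u} (r : ℕ → ℕ) (f : ℕ → Option α) : Prop :=
  ∀ i a, f i = some a → r i = i

section
variable {α : Type u} {r : ℕ → ℕ} {f g : ℕ → Option α}

theorem extL_of_lt {l : List α} {i : ℕ} (h : i < l.length) : extL l f i = some l[i] := by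
  simp [extL, h]

theorem extL_of_not_lt {l : List α} {i : ℕ} (h : ¬ i < l.length) :
    extL l f i = f (i - l.length) := by
  simp [extL, h]

theorem liftR_of_lt {n i : ℕ} (h : i < n) : liftR n r i = i := by
  simp [liftR, h]

theorem liftR_of_not_lt {n i : ℕ} (h : ¬ i < n) : liftR n r i = r (i - n) + n := by
  simp [liftR, h]

theorem extL_add (l : List α) (i : ℕ) : extL l f (i + l.length) = f i := by
  simp [extL]

theorem Maps.extL (h : Maps r f g) (l : List α) :
    Maps (liftR l.length r) (extL l f) (extL l g) := by
  intro i a hi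
  by_cases hl : i < l.length
  · rw [extL_of_lt hl] at hi; rwa [liftR_of_lt hl, extL_of_lt hl]
  · rw [extL_of_not_lt hl] at hi
    rw [liftR_of_not_lt hl, extL_add]
    exact h _ _ hi

theorem Maps.add (l : List α) : Maps (· + l.length) f (ARM.extL l f) := by
  intro i a hi
  rwa [extL_add]

theorem Reflects.extL (h : Reflects r f g) (l : List α) :
    Reflects (liftR l.length r) (extL l f) (extL l g) := by
  intro i a hi
  by_cases hl : i < l.length
  · rw [liftR_of_lt hl, extL_of_lt hl] at hi; rwa [extL_of_lt hl]
  · rw [liftR_of_not_lt hl, extL_add] at hi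
    rw [extL_of_not_lt hl]
    exact h _ _ hi

theorem Fixes.extL (h : Fixes r f) (l : List α) : Fixes (liftR l.length r) (extL l f) := by
  intro i a hi
  by_cases hl : i < l.length
  · exact liftR_of_lt hl
  · rw [extL_of_not_lt hl] at hi
    rw [liftR_of_not_lt hl, h _ _ hi]
    omega

end

theorem forall₂_map_left {α β γ : Type*} {R : α → β → Prop} {S : γ → β → Prop} {f : α → γ}
    {l : List α} {l' : List β} (h : List.Forall₂ R l l') (hf : ∀ a b, R a b → S (f a) b) :
    List.Forall₂ S (l.map f) l' := by
  induction h with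
  | nil => exact .nil
  | cons h _ ih => exact .cons (hf _ _ h) ih

theorem forall₂_of_map_left {α β γ : Type*} {R : α → β → Prop} {S : γ → β → Prop} {f : α → γ}
    {l : List α} {l' : List β} (h : List.Forall₂ S (l.map f) l')
    (hf : ∀ a b, S (f a) b → R a b) : List.Forall₂ R l l' :=
  (List.forall₂_map_left_iff.1 h).imp hf

theorem map_eq_self_of_forall₂ {α β : Type*} {R : α → β → Prop} {f : α → α}
    {l : List α} {l' : List β} (h : List.Forall₂ R l l') (hf : ∀ a b, R a b → f a = a) :
    l.map f = l := by
  induction h with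
  | nil => rfl
  | cons h _ ih => rw [List.map_cons, hf _ _ h, ih]

namespace Tm

theorem HasSort.ren {r : ℕ → ℕ} {s s' : ℕ → Option P.Base} (hr : Maps r s s') {t : Tm P}
    {b : P.Base} (h : t.HasSort s b) : (t.ren r).HasSort s' b := by
  induction t generalizing b with
  | var x => exact hr _ _ h
  | prim p => exact h
  | fn f args ih => exact ⟨h.1, fun i => ih i (h.2 i)⟩
  | fnv => exact h

theorem HasSort.of_ren {r : ℕ → ℕ} {s s' : ℕ → Option P.Base} (hr : Reflects r s s') {t : Tm P}
    {b : P.Base} (h : (t.ren r).HasSort s' b) : t.HasSort s b := by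
  induction t generalizing b with
  | var x => exact hr _ _ h
  | prim p => exact h
  | fn f args ih => exact ⟨h.1, fun i => ih i (h.2 i)⟩
  | fnv => exact h

theorem HasSort.ren_eq {r : ℕ → ℕ} {s : ℕ → Option P.Base} (hr : Fixes r s) {t : Tm P}
    {b : P.Base} (h : t.HasSort s b) : t.ren r = t := by
  induction t generalizing b with
  | var x => exact congrArg Tm.var (hr _ _ h)
  | prim p => rfl
  | fn f args ih => exact congrArg (Tm.fn f) (funext fun i => ih i (h.2 i))
  | fnv => rfl

theorem HasSort.subst {σ : ℕ → Tm P} {s s' : ℕ → Option P.Base}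
    (hs : ∀ i b, s i = some b → (σ i).HasSort s' b) {t : Tm P} {b : P.Base}
    (h : t.HasSort s b) : (t.subst σ).HasSort s' b := by
  induction t generalizing b with
  | var x => exact hs _ _ h
  | prim p => exact h
  | fn f args ih => exact ⟨h.1, fun i => ih i (h.2 i)⟩
  | fnv => exact h

end Tm

theorem hasSort_liftT {σ : ℕ → Tm P} {s s' : ℕ → Option P.Base}
    (hs : ∀ i b, s i = some b → (σ i).HasSort s' b) (l : List P.Base) :
    ∀ i b, extL l s i = some b → (liftT l.length σ i).HasSort (extL l s') b := by
  intro i b hi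
  by_cases hl : i < l.length
  · rw [extL_of_lt hl] at hi
    simp only [liftT, hl, if_true]
    exact (extL_of_lt hl).trans hi
  · rw [extL_of_not_lt hl] at hi
    simp only [liftT, hl, if_false]
    exact (hs _ _ hi).ren (Maps.add l)

namespace Pred

theorem HasArity.ren {r q : ℕ → ℕ} {s s' : ℕ → Option P.Base} {a a' : ℕ → Option (List P.Base)}
    (hr : Maps r s s') (hq : Maps q a a') {A : Pred P} {Bs : List P.Base}
    (h : A.HasArity s a Bs) : (A.ren r q).HasArity s' a' Bs := by
  induction A generalizing r q s s' a a' Bs with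
  | var X => exact hq _ _ h
  | top => exact h
  | eq b => exact h
  | op w hd ar ih =>
    refine ⟨h.1, fun i => ?_⟩
    obtain ⟨Bi, h₁, h₂⟩ := h.2 i
    exact ⟨Bi, ih i (hr.extL _) (hq.extL _) h₁,
      forall₂_map_left h₂ fun _ _ ht => ht.ren (hr.extL _)⟩

theorem HasArity.of_ren {r q : ℕ → ℕ} {s s' : ℕ → Option P.Base}
    {a a' : ℕ → Option (List P.Base)} (hr : Reflects r s s') (hq : Reflects q a a') {A : Pred P}
    {Bs : List P.Base} (h : (A.ren r q).HasArity s' a' Bs) : A.HasArity s a Bs := by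
  induction A generalizing r q s s' a a' Bs with
  | var X => exact hq _ _ h
  | top => exact h
  | eq b => exact h
  | op w hd ar ih =>
    refine ⟨h.1, fun i => ?_⟩
    obtain ⟨Bi, h₁, h₂⟩ := h.2 i
    exact ⟨Bi, ih i (hr.extL _) (hq.extL _) h₁,
      forall₂_of_map_left h₂ fun _ _ ht => ht.of_ren (hr.extL _)⟩

theorem HasArity.ren_eq {r q : ℕ → ℕ} {s : ℕ → Option P.Base} {a : ℕ → Option (List P.Base)}
    (hr : Fixes r s) (hq : Fixes q a) {A : Pred P} {Bs : List P.Base}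
    (h : A.HasArity s a Bs) : A.ren r q = A := by
  induction A generalizing r q s a Bs with
  | var X => exact congrArg Pred.var (hq _ _ h)
  | top => rfl
  | eq b => rfl
  | op w hd ar ih =>
    simp only [Pred.ren]
    congr 1 <;> funext i <;> obtain ⟨Bi, h₁, h₂⟩ := h.2 i
    · exact ih i (hr.extL _) (hq.extL _) h₁
    · exact map_eq_self_of_forall₂ h₂ fun _ _ ht => ht.ren_eq (hr.extL _)

end Pred

theorem hasArity_liftP {τ : ℕ → Pred P} {s' : ℕ → Option P.Base}
    {a a' : ℕ → Option (List P.Base)} (ht : ∀ i Bs, a i = some Bs → (τ i).HasArity s' a' Bs)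
    (l : List P.Base) (k : List (List P.Base)) :
    ∀ i Bs, extL k a i = some Bs →
      (liftP l.length k.length τ i).HasArity (extL l s') (extL k a') Bs := by
  intro i Bs hi
  by_cases hl : i < k.length
  · rw [extL_of_lt hl] at hi
    simp only [liftP, hl, if_true]
    exact (extL_of_lt hl).trans hi
  · rw [extL_of_not_lt hl] at hi
    simp only [liftP, hl, if_false]
    exact (ht _ _ hi).ren (Maps.add l) (Maps.add k)

theorem Pred.HasArity.subst {σ : ℕ → Tm P} {τ : ℕ → Pred P} {s s' : ℕ → Option P.Base}
    {a a' : ℕ → Option (List P.Base)} (hs : ∀ i b, s i = some b → (σ i).HasSort s' b)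
    (ht : ∀ i Bs, a i = some Bs → (τ i).HasArity s' a' Bs) {A : Pred P} {Bs : List P.Base}
    (h : A.HasArity s a Bs) : (A.subst σ τ).HasArity s' a' Bs := by
  induction A generalizing σ τ s s' a a' Bs with
  | var X => exact ht _ _ h
  | top => exact h
  | eq b => exact h
  | op w hd ar ih =>
    refine ⟨h.1, fun i => ?_⟩
    obtain ⟨Bi, h₁, h₂⟩ := h.2 i
    exact ⟨Bi, ih i (hasSort_liftT hs _) (hasArity_liftP ht _ _) h₁,
      forall₂_map_left h₂ fun _ _ h' => h'.subst (hasSort_liftT hs _)⟩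

namespace Fml

theorem WF.ren {r q : ℕ → ℕ} {s s' : ℕ → Option P.Base} {a a' : ℕ → Option (List P.Base)}
    (hr : Maps r s s') (hq : Maps q a a') {φ : Fml P} (h : φ.WF s a) : (φ.ren r q).WF s' a' := by
  obtain ⟨Bs, h₁, h₂⟩ := h
  exact ⟨Bs, h₁.ren hr hq, forall₂_map_left h₂ fun _ _ ht => ht.ren hr⟩

theorem WF.of_ren {r q : ℕ → ℕ} {s s' : ℕ → Option P.Base} {a a' : ℕ → Option (List P.Base)}
    (hr : Reflects r s s') (hq : Reflects q a a') {φ : Fml P} (h : (φ.ren r q).WF s' a') :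
    φ.WF s a := by
  obtain ⟨Bs, h₁, h₂⟩ := h
  exact ⟨Bs, h₁.of_ren hr hq, forall₂_of_map_left h₂ fun _ _ ht => ht.of_ren hr⟩

theorem WF.ren_eq {r q : ℕ → ℕ} {s : ℕ → Option P.Base} {a : ℕ → Option (List P.Base)}
    (hr : Fixes r s) (hq : Fixes q a) {φ : Fml P} (h : φ.WF s a) : φ.ren r q = φ := by
  obtain ⟨Bs, h₁, h₂⟩ := h
  simp only [Fml.ren, h₁.ren_eq hr hq,
    map_eq_self_of_forall₂ h₂ fun _ _ ht => ht.ren_eq hr]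

theorem WF.subst {σ : ℕ → Tm P} {τ : ℕ → Pred P} {s s' : ℕ → Option P.Base}
    {a a' : ℕ → Option (List P.Base)} (hs : ∀ i b, s i = some b → (σ i).HasSort s' b)
    (ht : ∀ i Bs, a i = some Bs → (τ i).HasArity s' a' Bs) {φ : Fml P} (h : φ.WF s a) :
    (φ.subst σ τ).WF s' a' := by
  obtain ⟨Bs, h₁, h₂⟩ := h
  exact ⟨Bs, h₁.subst hs ht, forall₂_map_left h₂ fun _ _ h' => h'.subst hs⟩

end Fml

/-! ### Well-formedness of target types under renaming and substitution -/

/-- The renamings `r`, `q`, `z` map well-formed types over `Γ` to well-formed types over `Γ'`. -/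
structure TCtx.Ren (Γ Γ' : TCtx P) (r q z : ℕ → ℕ) : Prop where
  sorts : Maps r Γ.sorts Γ'.sorts
  arities : Maps q Γ.arities Γ'.arities
  tys : ∀ a, a < Γ.tys → z a < Γ'.tys

/-- The renamings `r`, `q`, `z` reflect well-formedness. -/
structure TCtx.ReflRen (Γ Γ' : TCtx P) (r q z : ℕ → ℕ) : Prop where
  sorts : Reflects r Γ.sorts Γ'.sorts
  arities : Reflects q Γ.arities Γ'.arities
  tys : ∀ a, z a < Γ'.tys → a < Γ.tys

/-- The renamings `r`, `q`, `z` fix the variables bound by `Γ`. -/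
structure TCtx.Fix (Γ : TCtx P) (r q z : ℕ → ℕ) : Prop where
  sorts : Fixes r Γ.sorts
  arities : Fixes q Γ.arities
  tys : ∀ a, a < Γ.tys → z a = a

theorem TTy.sort_ren (τ : TTy P) (r q z : ℕ → ℕ) : (τ.ren r q z).sort = τ.sort := by
  cases τ <;> rfl

/-- Only an implication holds: a type variable has no sort but may be replaced by a refinement type.
-/
theorem TTy.sort_subst {τ : TTy P} {s : ℕ → Tm P} {t : ℕ → Pred P} {y : ℕ → TTy P} {b : P.Base}
    (h : τ.sort = some b) : (τ.subst s t y).sort = some b := by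
  cases τ <;> first | exact h | cases h

section
variable {Γ Γ' : TCtx P} {r q z : ℕ → ℕ}

namespace TCtx

/-- Well-formedness sees a binding only through its sort, so the two bound types need no other
relation. `TTy.WF.narrow` exploits this. -/
theorem Ren.var (h : Ren Γ Γ' r q z) {τ τ' : TTy P}
    (hs : ∀ b, τ.sort = some b → τ'.sort = some b) :
    Ren (.var τ :: Γ) (.var τ' :: Γ') (liftR 1 r) q z where
  sorts
    | 0, b, hb => hs b hb
    | i + 1, b, hb => by rw [liftR_one_succ]; exact h.sorts i b hb
  arities := h.arities
  tys := h.tys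

theorem Ren.var_ren (h : Ren Γ Γ' r q z) (τ : TTy P) :
    Ren (.var τ :: Γ) (.var (τ.ren r q z) :: Γ') (liftR 1 r) q z :=
  h.var fun b hb => by rwa [TTy.sort_ren]

theorem Ren.pred (h : Ren Γ Γ' r q z) (Bs : List P.Base) :
    Ren (.pred Bs :: Γ) (.pred Bs :: Γ') r (liftR 1 q) z where
  sorts := h.sorts
  arities
    | 0, b, hb => hb
    | i + 1, b, hb => by rw [liftR_one_succ]; exact h.arities i b hb
  tys := h.tys

theorem Ren.addP (h : Ren Γ Γ' r q z) : ∀ Bs : List (List P.Base),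
    Ren (Γ.addP Bs) (Γ'.addP Bs) r (liftR Bs.length q) z
  | [] => by rw [List.length_nil, liftR_zero]; exact h
  | B :: Bs => by rw [List.length_cons, liftR_succ]; exact (h.addP Bs).pred B

theorem Ren.ty (h : Ren Γ Γ' r q z) : Ren (.ty :: Γ) (.ty :: Γ') r q (liftR 1 z) where
  sorts := h.sorts
  arities := h.arities
  tys
    | 0, _ => Nat.succ_pos _
    | a + 1, ha => by
      rw [liftR_one_succ]; exact Nat.succ_lt_succ (h.tys a (Nat.lt_of_succ_lt_succ ha))

theorem Ren.hyp (h : Ren Γ Γ' r q z) (φ φ' : Fml P) : Ren (.hyp φ :: Γ) (.hyp φ' :: Γ') r q z where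
  sorts := h.sorts
  arities := h.arities
  tys := h.tys

theorem ReflRen.var (h : ReflRen Γ Γ' r q z) (τ : TTy P) :
    ReflRen (.var τ :: Γ) (.var (τ.ren r q z) :: Γ') (liftR 1 r) q z where
  sorts
    | 0, b, hb => (TTy.sort_ren τ r q z).symm.trans hb
    | i + 1, b, hb => by rw [liftR_one_succ] at hb; exact h.sorts i b hb
  arities := h.arities
  tys := h.tys

theorem ReflRen.pred (h : ReflRen Γ Γ' r q z) (Bs : List P.Base) :
    ReflRen (.pred Bs :: Γ) (.pred Bs :: Γ') r (liftR 1 q) z where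
  sorts := h.sorts
  arities
    | 0, b, hb => hb
    | i + 1, b, hb => by rw [liftR_one_succ] at hb; exact h.arities i b hb
  tys := h.tys

theorem ReflRen.addP (h : ReflRen Γ Γ' r q z) : ∀ Bs : List (List P.Base),
    ReflRen (Γ.addP Bs) (Γ'.addP Bs) r (liftR Bs.length q) z
  | [] => by rw [List.length_nil, liftR_zero]; exact h
  | B :: Bs => by rw [List.length_cons, liftR_succ]; exact (h.addP Bs).pred B

theorem ReflRen.ty (h : ReflRen Γ Γ' r q z) : ReflRen (.ty :: Γ) (.ty :: Γ') r q (liftR 1 z) where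
  sorts := h.sorts
  arities := h.arities
  tys
    | 0, _ => Nat.succ_pos _
    | a + 1, ha => by
      rw [liftR_one_succ] at ha; exact Nat.succ_lt_succ (h.tys a (Nat.lt_of_succ_lt_succ ha))

theorem Fix.var (h : Fix Γ r q z) (τ : TTy P) : Fix (.var τ :: Γ) (liftR 1 r) q z where
  sorts
    | 0, b, hb => rfl
    | i + 1, b, hb => by rw [liftR_one_succ, h.sorts i b hb]
  arities := h.arities
  tys := h.tys

theorem Fix.pred (h : Fix Γ r q z) (Bs : List P.Base) :
    Fix (.pred Bs :: Γ) r (liftR 1 q) z where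
  sorts := h.sorts
  arities
    | 0, b, hb => rfl
    | i + 1, b, hb => by rw [liftR_one_succ, h.arities i b hb]
  tys := h.tys

theorem Fix.addP (h : Fix Γ r q z) : ∀ Bs : List (List P.Base),
    Fix (Γ.addP Bs) r (liftR Bs.length q) z
  | [] => by rw [List.length_nil, liftR_zero]; exact h
  | B :: Bs => by rw [List.length_cons, liftR_succ]; exact (h.addP Bs).pred B

theorem Fix.ty (h : Fix Γ r q z) : Fix (.ty :: Γ) r q (liftR 1 z) where
  sorts := h.sorts
  arities := h.arities
  tys
    | 0, _ => rfl
    | a + 1, ha => by rw [liftR_one_succ, h.tys a (Nat.lt_of_succ_lt_succ ha)]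

theorem fix_nil : Fix ([] : TCtx P) r q z where
  sorts := fun _ _ h => nomatch h
  arities := fun _ _ h => nomatch h
  tys := fun _ h => absurd h (Nat.not_lt_zero _)

theorem ren_nil : Ren [] Γ' r q z where
  sorts := fun _ _ h => nomatch h
  arities := fun _ _ h => nomatch h
  tys := fun _ h => absurd h (Nat.not_lt_zero _)

end TCtx

theorem TTy.WF.ren {τ : TTy P} (h : τ.WF Γ) (hr : TCtx.Ren Γ Γ' r q z) :
    (τ.ren r q z).WF Γ' := by
  induction τ generalizing Γ Γ' r q z with
  | rfn B φ => exact Fml.WF.ren (hr.var_ren (.rfn B .top)).sorts hr.arities h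
  | arr τ₁ τ₂ ih₁ ih₂ => exact ⟨ih₁ h.1 hr, ih₂ h.2 (hr.var_ren τ₁)⟩
  | allP Bs τ ih => exact ih h (hr.addP Bs)
  | rcd D F ih => exact fun o => ih o (h o) hr
  | tvar a => exact hr.tys a h
  | all τ ih => exact ih h hr.ty

/-- Reflection provides strengthening: it undoes the weakenings built into transformed types and
recovers well-formedness outside a binder that does not occur. -/
theorem TTy.WF.of_ren {τ : TTy P} (h : (τ.ren r q z).WF Γ') (hr : TCtx.ReflRen Γ Γ' r q z) :
    τ.WF Γ := by
  induction τ generalizing Γ Γ' r q z with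
  | rfn B φ => exact Fml.WF.of_ren (hr.var (.rfn B .top)).sorts hr.arities h
  | arr τ₁ τ₂ ih₁ ih₂ => exact ⟨ih₁ h.1 hr, ih₂ h.2 (hr.var τ₁)⟩
  | allP Bs τ ih => exact ih h (hr.addP Bs)
  | rcd D F ih => exact fun o => ih o (h o) hr
  | tvar a => exact hr.tys a h
  | all τ ih => exact ih h hr.ty

/-- Over the empty context every renaming qualifies, so closed types, in particular those of
primitive values, are invariant under all renamings. -/
theorem TTy.WF.ren_eq {τ : TTy P} (h : τ.WF Γ) (hr : TCtx.Fix Γ r q z) : τ.ren r q z = τ := by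
  induction τ generalizing Γ r q z with
  | rfn B φ =>
    exact congrArg (TTy.rfn B) (Fml.WF.ren_eq (hr.var (.rfn B .top)).sorts hr.arities h)
  | arr τ₁ τ₂ ih₁ ih₂ => rw [TTy.ren, ih₁ h.1 hr, ih₂ h.2 (hr.var τ₁)]
  | allP Bs τ ih => rw [TTy.ren, ih h (hr.addP Bs)]
  | rcd D F ih => exact congrArg (TTy.rcd D) (funext fun o => ih o (h o) hr)
  | tvar a => rw [TTy.ren, hr.tys a h]
  | all τ ih => rw [TTy.ren, ih h hr.ty]

end

-- Standard weakenings, and well-formedness under simultaneous substitution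

namespace TCtx

theorem sorts_addP (Γ : TCtx P) : ∀ Bs : List (List P.Base), (Γ.addP Bs).sorts = Γ.sorts
  | [] => rfl
  | _ :: Bs => funext fun i => congrFun (sorts_addP Γ Bs) i

theorem tys_addP (Γ : TCtx P) : ∀ Bs : List (List P.Base), (Γ.addP Bs).tys = Γ.tys
  | [] => rfl
  | _ :: Bs => tys_addP Γ Bs

theorem arities_addP (Γ : TCtx P) : ∀ Bs : List (List P.Base),
    (Γ.addP Bs).arities = extL Bs Γ.arities
  | [] => by funext i; simp [extL, addP]
  | B :: Bs => by
    funext i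
    rcases i with _ | i
    · rfl
    · exact (congrFun (arities_addP Γ Bs) i).trans (by simp [extL])

theorem ren_add_one (Γ : TCtx P) (τ : TTy P) : Ren Γ (.var τ :: Γ) (· + 1) id id where
  sorts := fun _ _ h => h
  arities := fun _ _ h => h
  tys := fun _ h => h

theorem ren_ty (Γ : TCtx P) : Ren Γ (.ty :: Γ) id id (· + 1) where
  sorts := fun _ _ h => h
  arities := fun _ _ h => h
  tys := fun _ h => Nat.succ_lt_succ h

theorem ren_pred (Γ : TCtx P) (Bs : List P.Base) : Ren Γ (.pred Bs :: Γ) id (· + 1) id where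
  sorts := fun _ _ h => h
  arities := fun _ _ h => h
  tys := fun _ h => h

theorem ren_hyp (Γ : TCtx P) (φ : Fml P) : Ren Γ (.hyp φ :: Γ) id id id where
  sorts := fun _ _ h => h
  arities := fun _ _ h => h
  tys := fun _ h => h

theorem ren_addP (Γ : TCtx P) (Bs : List (List P.Base)) :
    Ren Γ (Γ.addP Bs) id (· + Bs.length) id where
  sorts := by rw [sorts_addP]; exact fun _ _ h => h
  arities := by rw [arities_addP]; exact Maps.add Bs
  tys := by rw [tys_addP]; exact fun _ h => h

/-- The substitutions `s`, `t`, `y` map well-formed types over `Γ` to well-formed types over `Γ'`. -/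
structure Sub (Γ Γ' : TCtx P) (s : ℕ → Tm P) (t : ℕ → Pred P) (y : ℕ → TTy P) : Prop where
  sorts : ∀ i b, Γ.sorts i = some b → (s i).HasSort Γ'.sorts b
  arities : ∀ i Bs, Γ.arities i = some Bs → (t i).HasArity Γ'.sorts Γ'.arities Bs
  tys : ∀ a, a < Γ.tys → (y a).WF Γ'

variable {Γ Γ' : TCtx P} {s : ℕ → Tm P} {t : ℕ → Pred P} {y : ℕ → TTy P}

theorem Sub.var (h : Sub Γ Γ' s t y) {τ τ' : TTy P}
    (hτ : ∀ b, τ.sort = some b → τ'.sort = some b) :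
    Sub (.var τ :: Γ) (.var τ' :: Γ') (liftT 1 s) (liftP 1 0 t) (liftY 1 0 0 y) where
  sorts
    | 0, b, hb => hτ b hb
    | i + 1, b, hb => by
      rw [liftT_one_succ]; exact (h.sorts i b hb).ren (ren_add_one Γ' τ').sorts
  arities i Bs hi := by
    rw [liftP_one_apply]
    exact (h.arities i Bs hi).ren (ren_add_one Γ' τ').sorts (ren_add_one Γ' τ').arities
  tys a ha := by rw [liftY_one_apply]; exact (h.tys a ha).ren (ren_add_one Γ' τ')

theorem Sub.addP (h : Sub Γ Γ' s t y) (Bs : List (List P.Base)) :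
    Sub (Γ.addP Bs) (Γ'.addP Bs) s (liftP 0 Bs.length t) (liftY 0 Bs.length 0 y) where
  sorts := by rw [sorts_addP, sorts_addP]; exact h.sorts
  arities := by
    have := hasArity_liftP h.arities [] Bs
    rw [sorts_addP, arities_addP, arities_addP]
    intro i A hi
    have := this i A hi
    rwa [show extL [] Γ'.sorts = Γ'.sorts from funext fun i => by simp [extL]] at this
  tys := by
    rw [tys_addP]
    intro a ha
    simp only [liftY, Nat.not_lt_zero, if_false]
    exact (h.tys a ha).ren (ren_addP Γ' Bs)

theorem Sub.ty (h : Sub Γ Γ' s t y) : Sub (.ty :: Γ) (.ty :: Γ') s t (liftY 0 0 1 y) where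
  sorts := h.sorts
  arities := h.arities
  tys
    | 0, _ => Nat.succ_pos _
    | a + 1, ha => by
      rw [liftY_zero_one_succ]; exact (h.tys a (Nat.lt_of_succ_lt_succ ha)).ren (ren_ty Γ')

end TCtx

theorem TTy.WF.subst {Γ Γ' : TCtx P} {s : ℕ → Tm P} {t : ℕ → Pred P} {y : ℕ → TTy P} {τ : TTy P}
    (h : τ.WF Γ) (hs : TCtx.Sub Γ Γ' s t y) : (τ.subst s t y).WF Γ' := by
  induction τ generalizing Γ Γ' s t y with
  | rfn B φ =>
    have := hs.var (τ := .rfn B .top) (τ' := .rfn B .top) fun _ h => h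
    exact Fml.WF.subst this.sorts this.arities h
  | arr τ₁ τ₂ ih₁ ih₂ => exact ⟨ih₁ h.1 hs, ih₂ h.2 (hs.var fun _ => TTy.sort_subst)⟩
  | allP Bs τ ih => exact ih h (hs.addP Bs)
  | rcd D F ih => exact fun o => ih o (h o) hs
  | tvar a => exact hs.tys a h
  | all τ ih => exact ih h hs.ty

namespace TCtx

/-- A sort is demanded only for variables of refinement type: well-formed formulas never mention the
others, so the sortless `fnv` may replace them. -/
theorem sub_inst (Γ : TCtx P) {τ : TTy P} {a : Tm P}
    (h : ∀ b, τ.sort = some b → a.HasSort Γ.sorts b) :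
    Sub (.var τ :: Γ) Γ (inst a) .var .tvar where
  sorts
    | 0, b, hb => h b hb
    | _ + 1, _, hb => hb
  arities := fun _ _ h => h
  tys := fun _ h => h

theorem sub_instP {Γ : TCtx P} {As : List (Pred P)} {Bs : List (List P.Base)}
    (h : List.Forall₂ Γ.PredWF As Bs) : Sub (Γ.addP Bs) Γ .var (instP As) .tvar where
  sorts := by rw [sorts_addP]; exact fun _ _ h => h
  arities := by
    rw [arities_addP]
    intro i B hi
    have hl := h.length_eq
    by_cases hi' : i < Bs.length
    · have hA : i < As.length := hl ▸ hi'
      rw [extL_of_lt hi'] at hi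
      cases hi
      simp only [instP, hA, dif_pos]
      exact h.get hA hi'
    · have hA : ¬ i < As.length := hl ▸ hi'
      rw [extL_of_not_lt hi'] at hi
      simp only [instP, hA, dif_neg, not_false_iff]
      rw [hl]; exact hi
  tys := by rw [tys_addP]; exact fun _ h => h

theorem sub_instY (Γ : TCtx P) {σ : TTy P} (h : σ.WF Γ) :
    Sub (.ty :: Γ) Γ .var .var (instY σ) where
  sorts := fun _ _ h => h
  arities := fun _ _ h => h
  tys
    | 0, _ => h
    | _ + 1, ha => Nat.lt_of_succ_lt_succ ha

/-- Adds the argument of an operation to the instantiation of its predicate variables, giving the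
simultaneous substitution of the operation rule. -/
theorem Sub.trans_inst {Γ Γ' : TCtx P} {τ : TTy P} {a : Tm P} {t : ℕ → Pred P} {y : ℕ → TTy P}
    (h : Sub Γ Γ' .var t y) (ha : ∀ b, τ.sort = some b → a.HasSort Γ'.sorts b) :
    Sub (.var τ :: Γ) Γ' (inst a) t y where
  sorts
    | 0, b, hb => ha b hb
    | i + 1, b, hb => h.sorts i b hb
  arities := h.arities
  tys := h.tys

end TCtx

/-! ### Semantics under renaming -/

theorem extV_liftR {α : Type u} {n : ℕ} (v : Fin n → α) (f : ℕ → α) (r : ℕ → ℕ) :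
    (fun i => extV v f (liftR n r i)) = extV v (fun i => f (r i)) := by
  funext i
  by_cases h : i < n <;> simp [extV, liftR, h]

theorem Tm.eval_ren (r : ℕ → ℕ) (e : ℕ → P.U) (t : Tm P) :
    (t.ren r).eval e = t.eval (fun i => e (r i)) := by
  induction t with
  | fn f args ih => simp only [ren, eval, ih]
  | _ => rfl

theorem Pred.eval_ren (r q : ℕ → ℕ) (e : ℕ → P.U) (g : ℕ → List P.U → Prop) (A : Pred P) :
    (A.ren r q).eval e g = A.eval (fun i => e (r i)) (fun i => g (q i)) := by
  induction A generalizing r q e g with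
  | op w hd ar ih =>
    simp only [ren, eval, ih, List.map_map, Function.comp_def, Tm.eval_ren, extV_liftR]
  | _ => rfl

/-- Renaming a formula amounts to precomposing the valuation, so entailments are weakened by pulling
valuations back. -/
theorem Fml.holds_ren (r q : ℕ → ℕ) (e : ℕ → P.U) (g : ℕ → List P.U → Prop) (φ : Fml P) :
    (φ.ren r q).Holds e g ↔ φ.Holds (fun i => e (r i)) (fun i => g (q i)) := by
  simp only [Holds, ren, Pred.eval_ren, List.map_map, Function.comp_def, Tm.eval_ren]

theorem TTy.sat_ren {τ : TTy P} {r q z : ℕ → ℕ} {e : ℕ → P.U} {g : ℕ → List P.U → Prop} :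
    (τ.ren r q z).Sat e g ↔ τ.Sat (fun i => e (liftR 1 r i)) (fun i => g (q i)) := by
  cases τ with
  | rfn B φ => exact and_congr Iff.rfl (Fml.holds_ren _ _ _ _ _)
  | _ => exact Iff.rfl

/-- Extend a valuation by one value. -/
def consV (a : P.U) (e : ℕ → P.U) : ℕ → P.U
  | 0 => a
  | i + 1 => e i

theorem consV_liftR (a : P.U) (e : ℕ → P.U) (r : ℕ → ℕ) :
    (fun i => consV a e (liftR 1 r i)) = consV a (fun i => e (r i)) := by
  funext i
  cases i <;> simp [consV]

/-- A refinement has its own bound variable at index `0`; putting the value of `x` there turns it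
into a statement about `x`. This is the semantic fact behind `TVTyped.var_of_lookup`. -/
theorem TCtx.Models.lookup {Γ : TCtx P} {e : ℕ → P.U} {g : ℕ → List P.U → Prop} {x : ℕ}
    {τ : TTy P} (hm : Γ.Models e g) (h : Γ.lookup x = some τ) : τ.Sat (consV (e x) e) g := by
  induction Γ generalizing e g x τ with
  | nil => cases h
  | cons E Γ ih =>
    cases E with
    | var σ =>
      cases x with
      | zero =>
        cases h
        rw [TTy.sat_ren, consV_liftR]
        have : consV (e 0) (fun i => e (i + 1)) = e := by funext i; cases i <;> rfl
        rw [this]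
        exact hm.1
      | succ x =>
        simp only [TCtx.lookup, Option.map_eq_some_iff] at h
        obtain ⟨τ', h, rfl⟩ := h
        rw [TTy.sat_ren, consV_liftR]
        exact ih hm.2 h
    | pred Bs =>
      simp only [TCtx.lookup, Option.map_eq_some_iff] at h
      obtain ⟨τ', h, rfl⟩ := h
      rw [TTy.sat_ren, consV_liftR]
      exact ih hm.2 h
    | hyp ψ => exact ih hm.2 h
    | ty =>
      simp only [TCtx.lookup, Option.map_eq_some_iff] at h
      obtain ⟨τ', h, rfl⟩ := h
      rw [TTy.sat_ren, consV_liftR]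
      exact ih (show TCtx.Models Γ e g from hm) h

/-! ### Weakening of target contexts -/

/-- `Γ'` weakens `Γ` along the renamings `r`, `q`, `z`. -/
structure TCtx.Wk (Γ Γ' : TCtx P) (r q z : ℕ → ℕ) : Prop extends TCtx.Ren Γ Γ' r q z where
  lookup : ∀ x τ, Γ.lookup x = some τ → Γ'.lookup (r x) = some (τ.ren r q z)
  models : ∀ e g, Γ'.Models e g → Γ.Models (fun i => e (r i)) (fun i => g (q i))

namespace TCtx.Wk
variable {Γ Γ' Γ'' : TCtx P} {r q z r' q' z' : ℕ → ℕ}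

theorem var (h : Wk Γ Γ' r q z) (τ : TTy P) :
    Wk (.var τ :: Γ) (.var (τ.ren r q z) :: Γ') (liftR 1 r) q z where
  toRen := h.toRen.var_ren τ
  lookup
    | 0, σ, hσ => by
      cases hσ
      simp [TCtx.lookup, TTy.ren_ren]
    | x + 1, σ, hσ => by
      simp only [TCtx.lookup, Option.map_eq_some_iff] at hσ
      obtain ⟨σ', h', rfl⟩ := hσ
      simp [TCtx.lookup, TTy.ren_ren, h.lookup _ _ h']
  models e g hm := by
    refine ⟨TTy.sat_ren.1 hm.1, ?_⟩
    simpa only [liftR_one_succ] using h.models _ _ hm.2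

theorem pred (h : Wk Γ Γ' r q z) (Bs : List P.Base) :
    Wk (.pred Bs :: Γ) (.pred Bs :: Γ') r (liftR 1 q) z where
  toRen := h.toRen.pred Bs
  lookup x σ hσ := by
    simp only [TCtx.lookup, Option.map_eq_some_iff] at hσ
    obtain ⟨σ', h', rfl⟩ := hσ
    simp [TCtx.lookup, TTy.ren_ren, h.lookup _ _ h']
  models e g hm := by
    refine ⟨hm.1, ?_⟩
    simpa only [liftR_one_succ] using h.models _ _ hm.2

theorem addP (h : Wk Γ Γ' r q z) : ∀ Bs : List (List P.Base),
    Wk (Γ.addP Bs) (Γ'.addP Bs) r (liftR Bs.length q) z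
  | [] => by rw [List.length_nil, liftR_zero]; exact h
  | B :: Bs => by rw [List.length_cons, liftR_succ]; exact (h.addP Bs).pred B

theorem hyp (h : Wk Γ Γ' r q z) (φ : Fml P) :
    Wk (.hyp φ :: Γ) (.hyp (φ.ren r q) :: Γ') r q z where
  toRen := h.toRen.hyp φ _
  lookup := h.lookup
  models _ _ hm := ⟨(Fml.holds_ren _ _ _ _ _).1 hm.1, h.models _ _ hm.2⟩

theorem ty (h : Wk Γ Γ' r q z) : Wk (.ty :: Γ) (.ty :: Γ') r q (liftR 1 z) where
  toRen := h.toRen.ty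
  lookup x σ hσ := by
    simp only [TCtx.lookup, Option.map_eq_some_iff] at hσ
    obtain ⟨σ', h', rfl⟩ := hσ
    simp [TCtx.lookup, TTy.ren_ren, h.lookup _ _ h']
  models := h.models

theorem add_one (Γ : TCtx P) (τ : TTy P) : Wk Γ (.var τ :: Γ) (· + 1) id id where
  toRen := ren_add_one Γ τ
  lookup x σ h := by simp [TCtx.lookup, h]
  models _ _ hm := hm.2

theorem add_ty (Γ : TCtx P) : Wk Γ (.ty :: Γ) id id (· + 1) where
  toRen := ren_ty Γ
  lookup x σ h := by simp [TCtx.lookup, h]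
  models _ _ hm := hm

theorem trans (h : Wk Γ Γ' r q z) (h' : Wk Γ' Γ'' r' q' z') :
    Wk Γ Γ'' (fun i => r' (r i)) (fun i => q' (q i)) (fun i => z' (z i)) where
  sorts _ _ hb := h'.sorts _ _ (h.sorts _ _ hb)
  arities _ _ hb := h'.arities _ _ (h.arities _ _ hb)
  tys _ ha := h'.tys _ (h.tys _ ha)
  lookup x σ hσ := by rw [h'.lookup _ _ (h.lookup _ _ hσ), TTy.ren_ren]
  models e g hm := h.models _ _ (h'.models _ _ hm)

/-- Weakening past a type variable and two term variables. -/
theorem up (Γ : TCtx P) (τ₁ τ₂ : TTy P) :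
    Wk Γ (.var τ₂ :: .var τ₁ :: .ty :: Γ) (· + 2) id (· + 1) :=
  ((add_ty Γ).trans (add_one _ τ₁)).trans (add_one _ τ₂)

end TCtx.Wk

/-! ### Target subtyping -/

theorem TTy.subst_congr {s s' : ℕ → Tm P} {t t' : ℕ → Pred P} {y y' : ℕ → TTy P} {τ : TTy P}
    (hs : ∀ i, s i = s' i) (ht : ∀ i, t i = t' i) (hy : ∀ i, y i = y' i) :
    τ.subst s t y = τ.subst s' t' y' := by
  rw [funext hs, funext ht, funext hy]

theorem TTy.subst_eq_self {τ : TTy P} {y : ℕ → TTy P} (hy : ∀ a, y a = .tvar a) :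
    τ.subst .var .var y = τ := by
  rw [show y = .tvar from funext hy, TTy.subst_var]

namespace TSub

theorem refl (Γ : TCtx P) (τ : TTy P) : TSub Γ τ τ := by
  induction τ generalizing Γ with
  | rfn B φ => exact .rfn fun _ _ _ h => h
  | arr τ₁ τ₂ ih₁ ih₂ => exact .arr (ih₁ _) (ih₂ _)
  | allP Bs τ ih => exact .allP (ih _)
  | rcd D F ih => exact .rcd (Finset.Subset.refl _) fun o ho => ih ⟨o, ho⟩ _
  | tvar a => exact .tvar
  | all τ ih =>
    -- Instantiating the bound variable of the left type with that of the right leaves the body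
    -- unchanged.
    refine .all (σ := .tvar 0) (Nat.succ_pos _) ?_
    rw [TTy.subst_eq_self fun a => by cases a <;> rfl]
    exact ih _

theorem ren {Γ Γ' : TCtx P} {r q z : ℕ → ℕ} {τ₁ τ₂ : TTy P} (h : TSub Γ τ₁ τ₂)
    (hw : TCtx.Wk Γ Γ' r q z) : TSub Γ' (τ₁.ren r q z) (τ₂.ren r q z) := by
  induction h generalizing Γ' r q z with
  | rfn h =>
    refine .rfn fun e g hm h₁ => ?_
    rw [Fml.holds_ren] at h₁ ⊢
    exact h _ _ ((hw.var (.rfn _ .top)).models _ _ hm) h₁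
  | arr _ _ ih₁ ih₂ => exact .arr (ih₁ hw) (ih₂ (hw.var _))
  | allP _ ih => exact .allP (ih (hw.addP _))
  | rcd h _ ih => exact .rcd h fun o ho => ih o ho hw
  | tvar => exact .tvar
  | all hσ _ ih =>
    -- The witness is renamed along with the types; what remains is that renaming commutes with
    -- instantiation.
    refine .all (hσ.ren hw.ty.toRen) ?_
    have := ih hw.ty
    rw [TTy.subst_ren] at this
    rw [TTy.ren_subst]
    refine Eq.mp (congrArg (TSub _ · _) ?_) this
    exact TTy.subst_congr (fun _ => rfl) (fun _ => rfl) fun a => by cases a <;> simp [TTy.ren]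

/-- No subtyping rule relates different type formers or different base types. Narrowing a context
along subtyping therefore keeps its sorts, which is all that well-formedness observes. -/
theorem sort_eq {Γ : TCtx P} {τ₁ τ₂ : TTy P} (h : TSub Γ τ₁ τ₂) : τ₁.sort = τ₂.sort := by
  cases h <;> rfl

end TSub

/-! ### Contexts of well-formed target judgements -/

theorem TCtx.WF.lookup {Γ : TCtx P} {x : ℕ} {τ : TTy P} (hΓ : Γ.WF) (h : Γ.lookup x = some τ) :
    τ.WF Γ := by
  induction Γ generalizing x τ with
  | nil => cases h
  | cons E Γ ih =>
    cases E with
    | var σ =>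
      cases x with
      | zero => cases h; exact hΓ.2.ren (ren_add_one Γ σ)
      | succ x =>
        simp only [TCtx.lookup, Option.map_eq_some_iff] at h
        obtain ⟨τ', h, rfl⟩ := h
        exact (ih hΓ.1 h).ren (ren_add_one Γ σ)
    | pred Bs =>
      simp only [TCtx.lookup, Option.map_eq_some_iff] at h
      obtain ⟨τ', h, rfl⟩ := h
      exact (ih hΓ h).ren (ren_pred Γ Bs)
    | hyp φ =>
      have := (ih hΓ.1 h).ren (ren_hyp Γ φ)
      rwa [TTy.ren_id] at this
    | ty =>
      simp only [TCtx.lookup, Option.map_eq_some_iff] at h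
      obtain ⟨τ', h, rfl⟩ := h
      exact (ih hΓ h).ren (ren_ty Γ)

theorem TCtx.lookup_sorts {Γ : TCtx P} {x : ℕ} {τ : TTy P} (h : Γ.lookup x = some τ) :
    Γ.sorts x = τ.sort := by
  induction Γ generalizing x τ with
  | nil => cases h
  | cons E Γ ih =>
    cases E with
    | var σ =>
      cases x with
      | zero => cases h; exact (TTy.sort_ren _ _ _ _).symm
      | succ x =>
        simp only [TCtx.lookup, Option.map_eq_some_iff] at h
        obtain ⟨τ', h, rfl⟩ := h
        exact (ih h).trans (TTy.sort_ren _ _ _ _).symm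
    | pred Bs =>
      simp only [TCtx.lookup, Option.map_eq_some_iff] at h
      obtain ⟨τ', h, rfl⟩ := h
      exact (ih h).trans (TTy.sort_ren _ _ _ _).symm
    | hyp φ => exact ih h
    | ty =>
      simp only [TCtx.lookup, Option.map_eq_some_iff] at h
      obtain ⟨τ', h, rfl⟩ := h
      exact (ih h).trans (TTy.sort_ren _ _ _ _).symm

theorem TCtx.WF.of_addP {Γ : TCtx P} : ∀ {Bs : List (List P.Base)}, (Γ.addP Bs).WF → Γ.WF
  | [], h => h
  | _ :: Bs, h => of_addP (Bs := Bs) h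

theorem TCtx.WF.addP {Γ : TCtx P} (h : Γ.WF) : ∀ Bs : List (List P.Base), (Γ.addP Bs).WF
  | [] => h
  | _ :: Bs => h.addP Bs


mutual
-- Well-formedness of the context is a premise at variables, at primitive values and at records,
-- which may be empty; elsewhere it is recovered by peeling off the binders of a premise. For
-- abstractions the peeled entries also show that the annotation is well-formed.
theorem TVTyped.ctx_wf : ∀ {Γ : TCtx P} {v : TVal P} {τ : TTy P}, TVTyped K Γ v τ → Γ.WF
  | _, _, _, .cvar h _ => h
  | _, _, _, .var h _ _ => h
  | _, _, _, .prim h => h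
  | _, _, _, .fix h => h.ctx_wf.1.1
  | _, _, _, .lam h => h.ctx_wf.1
  | _, _, _, .plam h => TCtx.WF.of_addP h.ctx_wf
  | _, _, _, .rcd h _ => h
  | _, _, _, .tlam h => h.ctx_wf
  | _, _, _, .sub h _ _ => h.ctx_wf
theorem TTyped.ctx_wf : ∀ {Γ : TCtx P} {c : TExp P} {τ : TTy P}, TTyped K Γ c τ → Γ.WF
  | _, _, _, .val h => h.ctx_wf
  | _, _, _, .app h _ => h.ctx_wf
  | _, _, _, .ite h _ _ => h.ctx_wf
  | _, _, _, .papp h _ => h.ctx_wf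
  | _, _, _, @TTyped.proj _ _ Γ v D G o ho h => h.ctx_wf
  | _, _, _, .tapp h _ => h.ctx_wf
  | _, _, _, .asc h => h.ctx_wf
  | _, _, _, .sub h _ _ => h.ctx_wf
end

/-! ### Weakening of target typing -/

theorem TVal.tm_ren (v : TVal P) (r q z : ℕ → ℕ) : (v.ren r q z).tm = v.tm.ren r := by
  cases v <;> rfl

@[simp] theorem inst_zero (a : Tm P) : inst a 0 = a := rfl

@[simp] theorem inst_succ (a : Tm P) (i : ℕ) : inst a (i + 1) = .var i := rfl

@[simp] theorem instY_zero (σ : TTy P) : instY σ 0 = σ := rfl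

@[simp] theorem instY_succ (σ : TTy P) (i : ℕ) : instY σ (i + 1) = .tvar i := rfl

theorem TTy.subst_inst_ren (τ : TTy P) (a : Tm P) (r q z : ℕ → ℕ) :
    (τ.subst (inst a) .var .tvar).ren r q z =
      (τ.ren (liftR 1 r) q z).subst (inst (a.ren r)) .var .tvar := by
  rw [subst_ren, ren_subst]
  exact subst_congr (fun i => by cases i <;> simp [Tm.ren]) (fun _ => rfl) fun _ => rfl

theorem instP_ren (As : List (Pred P)) (r q : ℕ → ℕ) (i : ℕ) :
    (instP As i).ren r q = instP (As.map (Pred.ren r q)) (liftR As.length q i) := by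
  by_cases h : i < As.length <;> simp [instP, liftR, h, Pred.ren]

theorem TTy.subst_instP_ren (τ : TTy P) (As : List (Pred P)) (r q z : ℕ → ℕ) :
    (τ.subst .var (instP As) .tvar).ren r q z =
      (τ.ren r (liftR As.length q) z).subst .var (instP (As.map (Pred.ren r q))) .tvar := by
  rw [subst_ren, ren_subst]
  exact subst_congr (fun _ => rfl) (fun i => instP_ren As r q i) fun _ => rfl

theorem TTy.subst_instY_ren (τ σ : TTy P) (r q z : ℕ → ℕ) :
    (τ.subst .var .var (instY σ)).ren r q z =
      (τ.ren r q (liftR 1 z)).subst .var .var (instY (σ.ren r q z)) := by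
  rw [subst_ren, ren_subst]
  exact subst_congr (fun _ => rfl) (fun _ => rfl) fun i => by cases i <;> simp [TTy.ren]

/-! ### Transformed contexts and well-formedness of transformed types -/

theorem Ctx.cps_addP (Γ : Ctx P) (Bs : List (List P.Base)) :
    (Γ.addP Bs).cps = Γ.cps.addP Bs := by
  simp [Ctx.cps, Ctx.addP, TCtx.addP, Function.comp_def, Entry.cps]

theorem Ctx.sorts_cps : ∀ (Γ : Ctx P) (x : ℕ), Γ.cps.sorts x = Γ.sorts x
  | [], _ => rfl
  | .var (.rfn _ _) :: _, 0 => rfl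
  | .var (.arr _ _) :: _, 0 => rfl
  | .var (.rfn _ _) :: Γ, x + 1 => Ctx.sorts_cps Γ x
  | .var (.arr _ _) :: Γ, x + 1 => Ctx.sorts_cps Γ x
  | .pred _ :: Γ, x => Ctx.sorts_cps Γ x
  | .hyp _ :: Γ, x => Ctx.sorts_cps Γ x

theorem Ctx.arities_cps : ∀ (Γ : Ctx P) (X : ℕ), Γ.cps.arities X = Γ.arities X
  | [], _ => rfl
  | .var _ :: Γ, X => Ctx.arities_cps Γ X
  | .pred _ :: _, 0 => rfl
  | .pred _ :: Γ, X + 1 => Ctx.arities_cps Γ X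
  | .hyp _ :: Γ, X => Ctx.arities_cps Γ X

theorem Ctx.fmlWF_cps {Γ : Ctx P} {φ : Fml P} : Γ.cps.FmlWF φ ↔ Γ.FmlWF φ := by
  rw [TCtx.FmlWF, Ctx.FmlWF, funext Γ.sorts_cps, funext Γ.arities_cps]

theorem Ctx.predWF_cps (Γ : Ctx P) : Γ.cps.PredWF = Γ.PredWF := by
  funext A Bs
  rw [TCtx.PredWF, Ctx.PredWF, funext Γ.sorts_cps, funext Γ.arities_cps]

/-- `∀ α. ς → (τ → α) → α` -/
def TTy.cpsPure (ς τ : TTy P) : TTy P :=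
  .all (.arr (ς.ren id id (· + 1)) (.arr (.arr (τ.ren (· + 1) id (· + 1)) (.tvar 0)) (.tvar 0)))

/-- `∀ _. ς → ((x : τ) → τ₁) → τ₂` -/
def TTy.cpsImp (ς τ τ₁ τ₂ : TTy P) : TTy P :=
  .all (.arr (ς.ren id id (· + 1))
    (.arr ((TTy.arr τ τ₁).ren (· + 1) id (· + 1)) (τ₂.ren (· + 2) id (· + 1))))

theorem TCtx.Ren.trans {Γ Γ' Γ'' : TCtx P} {r q z r' q' z' : ℕ → ℕ} (h : Ren Γ Γ' r q z)
    (h' : Ren Γ' Γ'' r' q' z') :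
    Ren Γ Γ'' (fun i => r' (r i)) (fun i => q' (q i)) (fun i => z' (z i)) where
  sorts _ _ hb := h'.sorts _ _ (h.sorts _ _ hb)
  arities _ _ hb := h'.arities _ _ (h.arities _ _ hb)
  tys _ ha := h'.tys _ (h.tys _ ha)

/-- The forward direction takes apart the type of a given derivation and relies on reflection to
undo the inner weakenings; the backward direction builds the contexts under `α`, `h` and `k`. -/
theorem TTy.cpsPure_wf {Γ : TCtx P} {ς τ : TTy P} :
    (cpsPure ς τ).WF Γ ↔ ς.WF Γ ∧ τ.WF Γ := by
  constructor
  · intro h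
    exact ⟨h.1.of_ren ⟨fun _ _ h => h, fun _ _ h => h, fun _ h => Nat.lt_of_succ_lt_succ h⟩,
      h.2.1.1.of_ren ⟨fun _ _ h => h, fun _ _ h => h, fun _ h => Nat.lt_of_succ_lt_succ h⟩⟩
  · intro h
    exact ⟨h.1.ren (TCtx.ren_ty Γ), ⟨h.2.ren ((TCtx.ren_ty Γ).trans (TCtx.ren_add_one _ _)),
      Nat.succ_pos _⟩, Nat.succ_pos _⟩

theorem TTy.cpsImp_wf {Γ : TCtx P} {ς τ τ₁ τ₂ : TTy P} :
    (cpsImp ς τ τ₁ τ₂).WF Γ ↔ ς.WF Γ ∧ (TTy.arr τ τ₁).WF Γ ∧ τ₂.WF Γ := by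
  constructor
  · intro h
    exact ⟨h.1.of_ren ⟨fun _ _ h => h, fun _ _ h => h, fun _ h => Nat.lt_of_succ_lt_succ h⟩,
      TTy.WF.of_ren (τ := .arr τ τ₁) h.2.1
        ⟨fun _ _ h => h, fun _ _ h => h, fun _ h => Nat.lt_of_succ_lt_succ h⟩,
      h.2.2.of_ren ⟨fun _ _ h => h, fun _ _ h => h, fun _ h => Nat.lt_of_succ_lt_succ h⟩⟩
  · intro h
    exact ⟨h.1.ren (TCtx.ren_ty Γ),
      TTy.WF.ren (τ := .arr τ τ₁) h.2.1 ((TCtx.ren_ty Γ).trans (TCtx.ren_add_one _ _)),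
      h.2.2.ren (((TCtx.ren_ty Γ).trans (TCtx.ren_add_one _ _)).trans (TCtx.ren_add_one _ _))⟩

theorem CTy.cps_pure (Sg : OSig P) (T : VTy P) :
    (CTy.mk Sg T .pure).cps = TTy.cpsPure Sg.cps T.cps := by
  rw [CTy.cps, TTy.cpsPure]

theorem CTy.cps_imp (Sg : OSig P) (T : VTy P) (C₁ C₂ : CTy P) :
    (CTy.mk Sg T (.imp C₁ C₂)).cps = TTy.cpsImp Sg.cps T.cps C₁.cps C₂.cps := by
  rw [CTy.cps, TTy.cpsImp]

mutual
theorem VTy.WF.cps : ∀ {T : VTy P} {Γ : Ctx P}, T.WF Γ → T.cps.WF Γ.cps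
  | .rfn _ _, _, h => Ctx.fmlWF_cps.2 h
  | .arr _ _, _, h => ⟨h.1.cps, CTy.WF.cps h.2⟩
theorem CTy.WF.cps : ∀ {C : CTy P} {Γ : Ctx P}, C.WF Γ → C.cps.WF Γ.cps
  | .mk _ _ .pure, _, h => by
    rw [CTy.cps_pure]
    exact TTy.cpsPure_wf.2 ⟨h.1.cps, h.2.1.cps⟩
  | .mk _ _ (.imp _ _), _, h => by
    rw [CTy.cps_imp]
    exact TTy.cpsImp_wf.2 ⟨h.1.cps, ⟨h.2.1.cps, CTy.WF.cps h.2.2.1⟩, CTy.WF.cps h.2.2.2⟩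
theorem OSig.WF.cps : ∀ {Sg : OSig P} {Γ : Ctx P}, Sg.WF Γ → Sg.cps.WF Γ.cps
  | .mk _ _, _, h => fun o => (h o).cps
theorem Scheme.WF.cps : ∀ {F : Scheme P} {Γ : Ctx P}, F.WF Γ → F.cps.WF Γ.cps
  | .mk Bs T₁ T₂ C₁ C₂, Γ, h => by
    have h₁ := h.1.cps
    have h₂ := h.2.1.cps
    have h₃ := h.2.2.1.cps
    have h₄ := h.2.2.2.cps
    change TTy.WF _ (.var T₁.cps :: (Γ.addP Bs).cps) at h₂
    change TTy.WF _ (.var T₂.cps :: .var T₁.cps :: (Γ.addP Bs).cps) at h₃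
    change TTy.WF _ (.var T₁.cps :: (Γ.addP Bs).cps) at h₄
    rw [Ctx.cps_addP] at h₁ h₂ h₃ h₄
    exact ⟨h₁, ⟨h₂, h₃⟩, h₄.ren (TCtx.ren_add_one _ _)⟩
end

theorem PrimTyping.cps_wf (K : PrimTyping P) (p : P.Prim) (Γ : TCtx P) : (K.ty p).cps.WF Γ := by
  have := TTy.WF.ren (VTy.WF.cps (K.wf p)) (Γ' := Γ) (r := id) (q := id) (z := id) TCtx.ren_nil
  rwa [TTy.ren_id] at this

theorem PrimTyping.cps_ren (K : PrimTyping P) (p : P.Prim) (r q z : ℕ → ℕ) :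
    (K.ty p).cps.ren r q z = (K.ty p).cps :=
  TTy.WF.ren_eq (VTy.WF.cps (K.wf p)) TCtx.fix_nil

theorem TTy.ren_ne_rfn {τ : TTy P} (h : ∀ B φ, τ ≠ .rfn B φ) (r q z : ℕ → ℕ) :
    ∀ B φ, τ.ren r q z ≠ .rfn B φ := by
  cases τ with
  | rfn B φ => exact absurd rfl (h B φ)
  | _ => exact fun _ _ h' => nomatch h'

theorem TCtx.forall₂_predWF_map {Γ Γ' : TCtx P} {r q z : ℕ → ℕ} (hw : Ren Γ Γ' r q z)
    {As : List (Pred P)} {Bs : List (List P.Base)} (h : List.Forall₂ Γ.PredWF As Bs) :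
    List.Forall₂ Γ'.PredWF (As.map (Pred.ren r q)) Bs :=
  forall₂_map_left h fun _ _ hA => hA.ren hw.sorts hw.arities

theorem TTy.wk_ren (τ : TTy P) (r q z : ℕ → ℕ) :
    τ.wk.ren (liftR 1 r) q z = (τ.ren r q z).wk := by
  simp only [TTy.ren_ren, liftR_one_succ]
  rfl

theorem TTy.ren_two_ren (τ : TTy P) (r q z : ℕ → ℕ) :
    (τ.ren (liftR 1 (· + 1)) id id).ren (liftR 1 (liftR 1 r)) q z =
      (τ.ren (liftR 1 r) q z).ren (liftR 1 (· + 1)) id id := by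
  simp only [TTy.ren_ren, liftR_comp, liftR_one_succ]
  rfl

-- Target typing under weakening

mutual
-- The target context must be assumed well-formed because the leaf rules check it. Under a binder
-- the assumption is maintained by renaming the well-formedness of the bound type, taken from
-- `ctx_wf` of the premise.
theorem TVTyped.ren : ∀ {Γ : TCtx P} {v : TVal P} {τ : TTy P}, TVTyped K Γ v τ →
    ∀ {Γ' : TCtx P} {r q z : ℕ → ℕ}, TCtx.Wk Γ Γ' r q z → Γ'.WF →
      TVTyped K Γ' (v.ren r q z) (τ.ren r q z)
  | _, _, _, .cvar _ hx, _, _, _, _, hw, hΓ => .cvar hΓ (hw.lookup _ _ hx)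
  | _, _, _, .var _ hx hτ, _, _, _, _, hw, hΓ =>
    .var hΓ (hw.lookup _ _ hx) (TTy.ren_ne_rfn hτ _ _ _)
  | _, _, _, .prim _, _, r, q, z, hw, hΓ => by
    rw [K.cps_ren]
    exact .prim hΓ
  | _, _, _, @TVTyped.fix _ _ Γ τ₁ τ₂ c h, _, r, q, z, hw, hΓ => by
    have hc := h.ctx_wf
    have h' := h.ren ((hw.var (.arr τ₁ τ₂)).var τ₁.wk)
      ⟨⟨hΓ, hc.1.2.ren hw.toRen⟩, hc.2.ren (hw.var (.arr τ₁ τ₂)).toRen⟩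
    rw [TTy.wk_ren, TTy.ren_two_ren, ← liftR_two] at h'
    exact .fix h'
  | _, _, _, .lam h, _, _, _, _, hw, hΓ =>
    .lam (h.ren (hw.var _) ⟨hΓ, h.ctx_wf.2.ren hw.toRen⟩)
  | _, _, _, .plam h, _, _, _, _, hw, hΓ => .plam (h.ren (hw.addP _) (hΓ.addP _))
  | _, _, _, .rcd _ h, _, _, _, _, hw, hΓ => .rcd hΓ fun o => (h o).ren hw hΓ
  | _, _, _, .tlam h, _, _, _, _, hw, hΓ => .tlam (h.ren hw.ty hΓ)
  | _, _, _, .sub h hs hτ, _, _, _, _, hw, hΓ =>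
    .sub (h.ren hw hΓ) (hs.ren hw) (hτ.ren hw.toRen)
theorem TTyped.ren : ∀ {Γ : TCtx P} {c : TExp P} {τ : TTy P}, TTyped K Γ c τ →
    ∀ {Γ' : TCtx P} {r q z : ℕ → ℕ}, TCtx.Wk Γ Γ' r q z → Γ'.WF →
      TTyped K Γ' (c.ren r q z) (τ.ren r q z)
  | _, _, _, .val h, _, _, _, _, hw, hΓ => .val (h.ren hw hΓ)
  | _, _, _, .app h₁ h₂, _, _, _, _, hw, hΓ => by
    rw [TTy.subst_inst_ren, ← TVal.tm_ren]
    exact .app (h₁.ren hw hΓ) (h₂.ren hw hΓ)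
  | _, _, _, .ite h h₁ h₂, _, r, q, z, hw, hΓ => by
    have h₁' := h₁.ren (hw.hyp _) ⟨hΓ, h₁.ctx_wf.2.ren hw.sorts hw.arities⟩
    have h₂' := h₂.ren (hw.hyp _) ⟨hΓ, h₂.ctx_wf.2.ren hw.sorts hw.arities⟩
    simp only [Fml.eq, Fml.ren, List.map, Pred.ren, Tm.ren, ← TVal.tm_ren _ r q z] at h₁' h₂'
    exact .ite (h.ren hw hΓ) h₁' h₂'
  | _, _, _, .papp h hA, _, _, _, _, hw, hΓ => by
    rw [TTy.subst_instP_ren, hA.length_eq]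
    exact .papp (h.ren hw hΓ) (TCtx.forall₂_predWF_map hw.toRen hA)
  | _, _, _, @TTyped.proj _ _ Γ v D G o ho h, _, _, _, _, hw, hΓ =>
    .proj (G := fun o => (G o).ren _ _ _) ho (h.ren hw hΓ)
  | _, _, _, .tapp h hσ, _, _, _, _, hw, hΓ => by
    rw [TTy.subst_instY_ren]
    exact .tapp (h.ren hw hΓ) (hσ.ren hw.toRen)
  | _, _, _, .asc h, _, _, _, _, hw, hΓ => .asc (h.ren hw hΓ)
  | _, _, _, .sub h hs hτ, _, _, _, _, hw, hΓ =>
    .sub (h.ren hw hΓ) (hs.ren hw) (hτ.ren hw.toRen)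
end

/-! ### Types of well-typed target terms are well-formed -/

/-- Only variables and primitive values can have a refinement type: the rules for the other forms
give types without a sort, and subsumption keeps the sort. For a primitive value, `K.base` and
`K.func` tie the assigned type to its declared sort. -/
theorem TVTyped.tm_hasSort : ∀ {Γ : TCtx P} {v : TVal P} {τ : TTy P}, TVTyped K Γ v τ →
    ∀ b, τ.sort = some b → v.tm.HasSort Γ.sorts b
  | _, _, _, .cvar _ hx, b, hb => (TCtx.lookup_sorts hx).trans hb
  | _, _, _, .var _ hx _, b, hb => (TCtx.lookup_sorts hx).trans hb
  | _, _, _, @TVTyped.prim _ _ Γ p _, b, hb => by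
    change P.primSort p = some b
    cases hp : P.primSort p with
    | none =>
      obtain ⟨T, C, h⟩ := K.func p hp
      rw [h] at hb
      cases hb
    | some b' =>
      obtain ⟨φ, h⟩ := K.base p b' hp
      rw [h] at hb
      exact hb
  | _, _, _, .sub h hs _, b, hb => h.tm_hasSort b (hs.sort_eq.trans hb)

mutual
-- Regularity is needed on the target side only. Applied to transformed premises, it supplies the
-- well-formedness that source rules do not record, such as that of the smaller type in a
-- subsumption.
theorem TVTyped.wf : ∀ {Γ : TCtx P} {v : TVal P} {τ : TTy P}, TVTyped K Γ v τ → τ.WF Γ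
  | _, _, _, @TVTyped.cvar _ _ _ _ B _ _ hx =>
    ⟨[B, B], rfl, .cons rfl (.cons (TCtx.lookup_sorts hx) .nil)⟩
  | _, _, _, .var hΓ hx _ => hΓ.lookup hx
  | _, _, _, .prim _ => K.cps_wf _ _
  | _, _, _, .fix h => h.ctx_wf.1.2
  | _, _, _, .lam h => ⟨h.ctx_wf.2, h.wf⟩
  | _, _, _, .plam h => h.wf
  | _, _, _, .rcd _ h => fun o => (h o).wf
  | _, _, _, .tlam h => h.wf
  | _, _, _, .sub _ _ h => h
theorem TTyped.wf : ∀ {Γ : TCtx P} {c : TExp P} {τ : TTy P}, TTyped K Γ c τ → τ.WF Γ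
  | _, _, _, .val h => h.wf
  | _, _, _, .app h₁ h₂ => h₁.wf.2.subst (TCtx.sub_inst _ h₂.tm_hasSort)
  | Γ, _, _, .ite _ h _ => by
    -- A hypothesis contributes no sort, arity or type variable, so the identity renaming leads out
    -- of its scope.
    have := h.wf.ren (Γ' := Γ) (r := id) (q := id) (z := id) ⟨fun _ _ h => h, fun _ _ h => h, fun _ h => h⟩
    rwa [TTy.ren_id] at this
  | _, _, _, .papp h hA => TTy.WF.subst h.wf (TCtx.sub_instP hA)
  | _, _, _, @TTyped.proj _ _ Γ v D G o ho h => h.wf ⟨o, ho⟩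
  | _, _, _, .tapp h hσ => TTy.WF.subst h.wf (TCtx.sub_instY _ hσ)
  | _, _, _, .asc h => h.wf
  | _, _, _, .sub _ _ h => h
end

/-! ### The transformation preserves subtyping -/

theorem TTy.cpsPure_ren (ς τ : TTy P) (r q z : ℕ → ℕ) :
    (cpsPure ς τ).ren r q z = cpsPure (ς.ren r q z) (τ.ren r q z) := by
  simp only [cpsPure, TTy.ren, TTy.ren_ren, liftR_one_succ, liftR_one_zero, id]

theorem TTy.cpsImp_ren (ς τ τ₁ τ₂ : TTy P) (r q z : ℕ → ℕ) :
    (cpsImp ς τ τ₁ τ₂).ren r q z =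
      cpsImp (ς.ren r q z) (τ.ren r q z) (τ₁.ren (liftR 1 r) q z) (τ₂.ren r q z) := by
  simp only [cpsImp, TTy.ren, TTy.ren_ren, liftR_one_succ, liftR_comp, id]

theorem TTy.ren_subst_tvar {τ : TTy P} {r q z z' : ℕ → ℕ} {y : ℕ → TTy P}
    (hy : ∀ a, y (z a) = .tvar (z' a)) : (τ.ren r q z).subst .var .var y = τ.ren r q z' := by
  rw [ren_subst, ren_eq_subst]
  exact subst_congr (fun _ => rfl) (fun _ => rfl) hy

/-- The action `z` on the remaining type variables is left open to cover both uses: the identity for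
type application, and the shift past the new variable in the subtyping rule for quantifiers. -/
theorem TTy.cpsPure_body_subst (ς τ : TTy P) (z : ℕ → ℕ) (y : ℕ → TTy P)
    (hy : ∀ a, y (a + 1) = .tvar (z a)) :
    (TTy.arr (ς.ren id id (· + 1))
      (.arr (.arr (τ.ren (· + 1) id (· + 1)) (.tvar 0)) (.tvar 0))).subst .var .var y =
      .arr (ς.ren id id z)
        (.arr (.arr (τ.ren (· + 1) id z) ((y 0).ren (· + 2) id id)) ((y 0).ren (· + 2) id id)) := by
  simp only [TTy.subst, liftT_var, liftP_var, liftY_one_apply, TTy.ren_ren, id]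
  rw [ren_subst_tvar hy, ren_subst_tvar (z' := z) fun a => by simp [hy, TTy.ren]]
  rfl

theorem TTy.cpsImp_body_subst (ς τ τ₁ τ₂ : TTy P) (σ : TTy P) :
    (TTy.arr (ς.ren id id (· + 1)) (.arr ((TTy.arr τ τ₁).ren (· + 1) id (· + 1))
      (τ₂.ren (· + 2) id (· + 1)))).subst .var .var (instY σ) =
      .arr ς (.arr ((TTy.arr τ τ₁).wk) (τ₂.ren (· + 2) id id)) := by
  rw [TTy.subst, TTy.subst, liftT_var, liftT_var, liftP_var, liftP_var,
    ren_subst_tvar (y := instY σ) (z' := id) fun a => rfl, ren_subst_tvar (z' := id) fun a => by simp [TTy.ren],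
    ren_subst_tvar (z' := id) fun a => by simp [TTy.ren], TTy.ren_id]

namespace TSub
variable {Γ : TCtx P} {ς ς' τ τ' τ₁ τ₁' τ₂ τ₂' : TTy P}

theorem cpsPure (hς : TSub Γ ς' ς) (hτ : TSub Γ τ τ') :
    TSub Γ (.cpsPure ς τ) (.cpsPure ς' τ') := by
  refine .all (σ := .tvar 0) (Nat.succ_pos _) ?_
  rw [TTy.subst_eq_self fun a => by cases a <;> rfl]
  exact .arr (hς.ren (.add_ty Γ))
    (.arr (.arr (hτ.ren ((TCtx.Wk.add_ty Γ).trans (.add_one _ _))) .tvar) .tvar)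

theorem cpsImp (hς : TSub Γ ς' ς) (hτ : TSub Γ (.arr τ' τ₁') (.arr τ τ₁)) (h₂ : TSub Γ τ₂ τ₂') :
    TSub Γ (.cpsImp ς τ τ₁ τ₂) (.cpsImp ς' τ' τ₁' τ₂') := by
  refine .all (σ := .tvar 0) (Nat.succ_pos _) ?_
  rw [TTy.subst_eq_self fun a => by cases a <;> rfl]
  exact .arr (hς.ren (.add_ty Γ)) (.arr (hτ.ren ((TCtx.Wk.add_ty Γ).trans (.add_one _ _)))
    (h₂.ren (((TCtx.Wk.add_ty Γ).trans (.add_one _ _)).trans (.add_one _ _))))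

/-- With `α` instantiated to `τ₂`, a pure computation takes a continuation `τ → τ₂` and returns
`τ₂`. The impure continuation `(x : τ') → τ₁` may serve as such a continuation exactly by `hτ` and
`h₁`. Hypothesis `h₂` makes the instantiation legitimate. -/
theorem cpsEmbed (hς : TSub Γ ς' ς) (hτ : TSub Γ τ τ') (h₁ : TSub (.var τ :: Γ) τ₁ τ₂.wk)
    (h₂ : τ₂.WF Γ) : TSub Γ (.cpsPure ς τ) (.cpsImp ς' τ' τ₁ τ₂) := by
  refine .all (σ := τ₂.ren id id (· + 1)) (h₂.ren (TCtx.ren_ty Γ)) ?_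
  rw [TTy.cpsPure_body_subst ς τ (· + 1) (hy := by intro; rfl)]
  simp only [TTy.ren_ren]
  refine .arr (hς.ren (.add_ty Γ)) (.arr ?_ (.refl _ _))
  have := TSub.ren (.arr hτ h₁) ((TCtx.Wk.add_ty Γ).trans (.add_one _ (ς'.ren id id (· + 1))))
  simp only [TTy.ren, TTy.ren_ren, liftR_one_succ] at this
  exact this

end TSub

theorem TTy.WF.narrow {Γ : TCtx P} {τ τ₁ τ₂ : TTy P} (h : τ.WF (.var τ₁ :: Γ))
    (hs : τ₁.sort = τ₂.sort) : τ.WF (.var τ₂ :: Γ) := by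
  have hr : TCtx.Ren Γ Γ id id id := ⟨fun _ _ h => h, fun _ _ h => h, fun _ h => h⟩
  have := h.ren (hr.var (τ := τ₁) (τ' := τ₂) fun b hb => hs ▸ hb)
  rwa [liftR_id, TTy.ren_id] at this

theorem TTy.WF.of_wk {Γ : TCtx P} {τ σ : TTy P} (h : τ.wk.WF (.var σ :: Γ)) : τ.WF Γ :=
  h.of_ren ⟨fun _ _ h => h, fun _ _ h => h, fun _ h => h⟩

/-- Refinements are unchanged, and function types constrain nothing before or after the transform.
An entailment quantifies over the models of its context, so this direction suffices to transfer it.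
-/
theorem Ctx.models_of_cps : ∀ {Γ : Ctx P} {e : ℕ → P.U} {g : ℕ → List P.U → Prop},
    Γ.cps.Models e g → Γ.Models e g
  | [], _, _, _ => trivial
  | .var (.rfn _ _) :: _, _, _, h => ⟨h.1.1, h.1.2, models_of_cps h.2⟩
  | .var (.arr _ _) :: Γ, _, _, h => models_of_cps (Γ := Γ) h.2
  | .pred _ :: _, _, _, h => ⟨h.1, models_of_cps h.2⟩
  | .hyp _ :: _, _, _, h => ⟨h.1, models_of_cps h.2⟩

mutual
-- The well-formedness assumptions ultimately serve the witness of `TSub.cpsEmbed`; they concern the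
-- transforms because that is what target regularity provides. A codomain is well-formed under its
-- own domain but compared under the other one, hence the narrowings.
theorem VSub.cps : ∀ {Γ : Ctx P} {T₁ T₂ : VTy P}, VSub Γ T₁ T₂ → T₁.cps.WF Γ.cps →
    T₂.cps.WF Γ.cps → TSub Γ.cps T₁.cps T₂.cps
  | _, _, _, @VSub.rfn _ Γ B φ₁ φ₂ h, _, _ =>
    .rfn fun e g hm => h e g (Ctx.models_of_cps (Γ := .var (.rfn B .top) :: Γ) hm)
  | _, _, _, .arr hT hC, h₁, h₂ =>
    have hT' := hT.cps h₂.1 h₁.1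
    .arr hT' (hC.cps (h₁.2.narrow hT'.sort_eq.symm) h₂.2)
theorem CSub.cps : ∀ {Γ : Ctx P} {C₁ C₂ : CTy P}, CSub Γ C₁ C₂ → C₁.cps.WF Γ.cps →
    C₂.cps.WF Γ.cps → TSub Γ.cps C₁.cps C₂.cps
  | _, _, _, .mk hO hT .pure, h₁, h₂ => by
    rw [CTy.cps_pure] at h₁ h₂ ⊢
    rw [CTy.cps_pure]
    rw [TTy.cpsPure_wf] at h₁ h₂
    exact .cpsPure (hO.cps h₂.1 h₁.1) (hT.cps h₁.2 h₂.2)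
  | _, _, _, .mk hO hT (.imp hC hC'), h₁, h₂ => by
    rw [CTy.cps_imp] at h₁ h₂ ⊢
    rw [CTy.cps_imp]
    rw [TTy.cpsImp_wf] at h₁ h₂
    have hT' := hT.cps h₁.2.1.1 h₂.2.1.1
    exact .cpsImp (hO.cps h₂.1 h₁.1)
      (.arr hT' (hC.cps (h₂.2.1.2.narrow hT'.sort_eq.symm) h₁.2.1.2)) (hC'.cps h₁.2.2 h₂.2.2)
  | _, _, _, .mk hO hT (.embed hC), h₁, h₂ => by
    rw [CTy.cps_pure] at h₁ ⊢
    rw [CTy.cps_imp] at h₂ ⊢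
    rw [TTy.cpsPure_wf] at h₁
    rw [TTy.cpsImp_wf] at h₂
    have hT' := hT.cps h₁.2 h₂.2.1.1
    have hC' := hC.cps (h₂.2.1.2.narrow hT'.sort_eq.symm)
      (by rw [← CTy.cps_ren _ _ id]; exact h₂.2.2.ren (TCtx.ren_add_one _ _))
    rw [← CTy.cps_ren _ _ id] at hC'
    exact .cpsEmbed (hO.cps h₂.1 h₁.1) hT' hC' h₂.2.2
theorem OSub.cps : ∀ {Γ : Ctx P} {S₁ S₂ : OSig P}, OSub Γ S₁ S₂ → S₁.cps.WF Γ.cps →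
    S₂.cps.WF Γ.cps → TSub Γ.cps S₁.cps S₂.cps
  | _, _, _, .mk h hF, h₁, h₂ => .rcd h fun o ho => (hF o ho).cps (h₁ ⟨o, h ho⟩) (h₂ ⟨o, ho⟩)
theorem SSub.cps : ∀ {Γ : Ctx P} {F₁ F₂ : Scheme P}, SSub Γ F₁ F₂ → F₁.cps.WF Γ.cps →
    F₂.cps.WF Γ.cps → TSub Γ.cps F₁.cps F₂.cps
  | _, _, _, @SSub.mk _ Γ Bs T₁ T₂ C₁ C₂ T₁' T₂' C₁' C₂' hT hA hC, h₁, h₂ => by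
    change TTy.WF (.arr _ _) (Γ.cps.addP Bs) at h₁ h₂
    rw [← Ctx.cps_addP] at h₁ h₂
    have hT' := hT.cps h₂.1 h₁.1
    have hA' := hA.cps h₂.2.1 (TTy.WF.narrow h₁.2.1 hT'.sort_eq.symm)
    -- The result type lies under the continuation binder without depending on it: that weakening is
    -- stripped here and restored by `ren` at the end.
    have hC' := hC.cps (TTy.WF.narrow h₁.2.2.of_wk hT'.sort_eq.symm) h₂.2.2.of_wk
    refine .allP ?_
    rw [← Ctx.cps_addP]
    exact .arr hT' (.arr hA' (hC'.ren (.add_one _ _)))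
end

/-! ### Derived target typing rules -/

theorem TTy.ren_subst_inst {τ : TTy P} {r r' q z : ℕ → ℕ} {a : Tm P}
    (h : ∀ i, inst a (r i) = .var (r' i)) :
    (τ.ren r q z).subst (inst a) .var .tvar = τ.ren r' q z := by
  rw [ren_subst, ren_eq_subst]
  exact subst_congr h (fun _ => rfl) fun _ => rfl

theorem TTy.wk_subst_inst (τ : TTy P) (a : Tm P) : τ.wk.subst (inst a) .var .tvar = τ := by
  rw [ren_subst_inst (r' := id) fun _ => rfl, ren_id]

theorem TTy.ren_two_subst_inst (τ : TTy P) (a b : Tm P) :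
    ((τ.ren (· + 2) id id).subst (liftT 1 (inst a)) .var .tvar).subst (inst b) .var .tvar = τ := by
  rw [ren_subst, subst_subst]
  refine (subst_congr (fun i => ?_) (fun _ => rfl) fun _ => rfl).trans (subst_var τ)
  simp [Tm.ren, Tm.subst]

/-- Instantiating the answer type variable with `σ` determines both the answer type of the
continuation and the type of the whole application. -/
theorem TTyped.cpsApp_pure {Γ : TCtx P} {c : TExp P} {ς τ σ : TTy P} {v₁ v₂ : TVal P}
    (hc : TTyped K Γ c (.cpsPure ς τ)) (hσ : σ.WF Γ) (h₁ : TVTyped K Γ v₁ ς)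
    (h₂ : TVTyped K Γ v₂ (.arr τ σ.wk)) : TTyped K Γ (cpsApp c σ v₁ v₂) σ := by
  have h := TTyped.tapp (m := .st) hc hσ
  rw [TTy.cpsPure_body_subst _ _ id _ fun _ => rfl, TTy.ren_id] at h
  have h' := TTyped.app (m := .st) h h₁
  simp only [TTy.subst, liftP_var, liftY_tvar] at h'
  rw [TTy.wk_subst_inst, TTy.ren_subst, TTy.subst_congr (s' := fun i => .var (i + 1))
    (fun i => by simp [Tm.ren]) (fun _ => rfl) (fun _ => rfl), ← TTy.ren_eq_subst] at h'
  have h'' := TTyped.app (m := .st) h' h₂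
  rwa [instY_zero, TTy.wk_subst_inst] at h''

/-- The quantifier of an impure type is vacuous, so `σ` matters only through its well-formedness and
the result is the fixed answer type `τ₂`. -/
theorem TTyped.cpsApp_imp {Γ : TCtx P} {c : TExp P} {ς τ τ₁ τ₂ σ : TTy P} {v₁ v₂ : TVal P}
    (hc : TTyped K Γ c (.cpsImp ς τ τ₁ τ₂)) (hσ : σ.WF Γ) (h₁ : TVTyped K Γ v₁ ς)
    (h₂ : TVTyped K Γ v₂ (.arr τ τ₁)) : TTyped K Γ (cpsApp c σ v₁ v₂) τ₂ := by
  have h := TTyped.tapp (m := .st) hc hσ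
  rw [TTy.cpsImp_body_subst] at h
  have h' := TTyped.app (m := .st) h h₁
  rw [TTy.subst, TTy.wk_subst_inst, liftP_var, liftY_tvar] at h'
  have h'' := TTyped.app (m := .st) h' h₂
  rwa [TTy.ren_two_subst_inst] at h''

theorem TTyped.cpsAbs_pure {Γ : TCtx P} {c : TExp P} {ς τ : TTy P}
    (h : TTyped K (.var (.arr (τ.ren (· + 1) id (· + 1)) (.tvar 0)) ::
      .var (ς.ren id id (· + 1)) :: .ty :: Γ) c (.tvar 0)) :
    TTyped K Γ (cpsAbs (ς.ren id id (· + 1)) (.arr (τ.ren (· + 1) id (· + 1)) (.tvar 0)) c)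
      (.cpsPure ς τ) :=
  .val (.tlam (.val (.lam (.val (.lam h)))))

theorem TTyped.cpsAbs_imp {Γ : TCtx P} {c : TExp P} {ς τ τ₁ τ₂ : TTy P}
    (h : TTyped K (.var ((TTy.arr τ τ₁).ren (· + 1) id (· + 1)) ::
      .var (ς.ren id id (· + 1)) :: .ty :: Γ) c τ₂.up) :
    TTyped K Γ (cpsAbs (ς.ren id id (· + 1)) ((TTy.arr τ τ₁).ren (· + 1) id (· + 1)) c)
      (.cpsImp ς τ τ₁ τ₂) :=
  .val (.tlam (.val (.lam (.val (.lam h)))))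

/-- A variable has the type assigned to it by the context, also if that is a refinement type. -/
theorem TVTyped.var_of_lookup {Γ : TCtx P} {x : ℕ} {τ : TTy P} (hΓ : Γ.WF)
    (h : Γ.lookup x = some τ) : TVTyped K Γ (.var x) τ := by
  cases τ with
  | rfn B φ =>
    refine .sub (.cvar hΓ h) (.rfn fun e g hm he => ?_) (hΓ.lookup h)
    -- The singleton type gives `e 0 = e (x + 1)`. Hence placing the value of `x` at index `0`
    -- changes nothing, and the refinement that the context asserts of `x` holds of the bound
    -- variable.
    obtain ⟨a, ha⟩ := he
    simp only [Fml.eq, List.map, Tm.eval, List.cons.injEq, and_true] at ha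
    have hs := (TCtx.Models.lookup hm.2 h).2
    have : consV (e (x + 1)) (fun i => e (i + 1)) = e := by
      funext i
      cases i with
      | zero => exact ha.2.trans ha.1.symm
      | succ i => rfl
    rwa [this] at hs
  | _ => exact .var hΓ h fun _ _ h' => nomatch h'

theorem Val.tm_cps (v : Val P) : v.cps.tm = v.tm := by
  cases v <;> rfl

theorem Ctx.lookup_cps : ∀ {Γ : Ctx P} {x : ℕ} {T : VTy P}, Γ.lookup x = some T →
    Γ.cps.lookup x = some T.cps
  | .var _ :: _, 0, _, h => by
    cases h
    exact congrArg some (VTy.cps_ren _ _ _ _)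
  | .var _ :: Γ, x + 1, _, h => by
    simp only [Ctx.lookup, Option.map_eq_some_iff] at h
    obtain ⟨T', h, rfl⟩ := h
    rw [← VTy.cps_ren _ _ id]
    exact congrArg (Option.map TTy.wk) (lookup_cps (Γ := Γ) h)
  | .pred _ :: Γ, x, _, h => by
    simp only [Ctx.lookup, Option.map_eq_some_iff] at h
    obtain ⟨T', h, rfl⟩ := h
    rw [← VTy.cps_ren _ _ id]
    exact congrArg (Option.map (TTy.ren id (· + 1) id)) (lookup_cps (Γ := Γ) h)
  | .hyp _ :: Γ, _, _, h => lookup_cps (Γ := Γ) h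

theorem VTy.cps_ne_rfn {T : VTy P} (h : ∀ B φ, T ≠ .rfn B φ) : ∀ B φ, T.cps ≠ .rfn B φ := by
  cases T with
  | rfn B φ => exact absurd rfl (h B φ)
  | arr T C => exact fun _ _ h' => nomatch h'

-- Transformed `let` and operation calls, over arbitrary target types

theorem TTy.ren_congr {r q z r' q' z' : ℕ → ℕ} {τ : TTy P} (hr : ∀ i, r i = r' i)
    (hq : ∀ i, q i = q' i) (hz : ∀ i, z i = z' i) : τ.ren r q z = τ.ren r' q' z' := by
  rw [funext hr, funext hq, funext hz]

theorem TTy.wk_up1 (τ : TTy P) :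
    τ.wk.ren (liftR 1 (· + 2)) id (· + 1) = (τ.ren (· + 2) id (· + 1)).wk := by
  simp only [wk, ren_ren]
  exact ren_congr (fun i => by simp) (fun _ => rfl) fun _ => rfl

theorem TTy.up_subst_inst (τ : TTy P) (a : Tm P) :
    τ.wk.up1.subst (inst a) .var .tvar = τ.up := by
  rw [up1, wk_up1, wk_subst_inst]

/-- The transformed call applies the handler entry to predicates and then to the argument; the two
successive instantiations agree with the simultaneous one of the source rule. -/
theorem TTy.subst_liftP_subst_inst (τ : TTy P) (a : Tm P) (t : ℕ → Pred P) :
    (τ.subst .var (liftP 1 0 t) .tvar).subst (inst a) .var .tvar = τ.subst (inst a) t .tvar := by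
  rw [subst_subst]
  refine subst_congr (fun _ => rfl) (fun i => ?_) fun _ => rfl
  rw [liftP_one_apply, Pred.ren_subst]
  exact Pred.subst_var _

theorem TTyped.letP {Γ : TCtx P} {ς τ₁ τ₂ : TTy P} {c₁ c₂ : TExp P}
    (h₁ : TTyped K Γ c₁ (.cpsPure ς τ₁))
    (h₂ : TTyped K (.var τ₁ :: Γ) c₂ (.cpsPure ς.wk τ₂.wk)) :
    TTyped K Γ (cpsAbs (ς.ren id id (· + 1)) (.arr (τ₂.ren (· + 1) id (· + 1)) (.tvar 0))
      (cpsApp c₁.up (.tvar 0) (.var 1)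
        (.lam .dy τ₁.up (cpsApp c₂.up1 (.tvar 0) (.var 2) (.var 1))))) (.cpsPure ς τ₂) := by
  have hw₁ := TTy.cpsPure_wf.1 h₁.wf
  have hw₂ := (TTy.cpsPure_wf.1 h₂.wf).2.of_wk
  have hw : (TTy.cpsPure ς τ₂).WF Γ := TTy.cpsPure_wf.2 ⟨hw₁.1, hw₂⟩
  have wk := TCtx.Wk.up Γ (ς.ren id id (· + 1)) (.arr (τ₂.ren (· + 1) id (· + 1)) (.tvar 0))
  -- The annotations of `h` and `k` are the two domains inside `cpsPure ς τ₂`, so `hw` contains the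
  -- well-formedness of the extended context.
  have hΔ : TCtx.WF (.var (.arr (τ₂.ren (· + 1) id (· + 1)) (.tvar 0)) ::
      .var (ς.ren id id (· + 1)) :: .ty :: Γ) := ⟨⟨h₁.ctx_wf, hw.1⟩, hw.2.1⟩
  have hΔ' : TCtx.WF (.var τ₁.up :: .var (.arr (τ₂.ren (· + 1) id (· + 1)) (.tvar 0)) ::
      .var (ς.ren id id (· + 1)) :: .ty :: Γ) := ⟨hΔ, hw₁.2.ren wk.toRen⟩
  refine .cpsAbs_pure ?_
  have h₁' := h₁.ren wk hΔ
  have h₂' := h₂.ren (wk.var τ₁) hΔ'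
  rw [TTy.cpsPure_ren] at h₁' h₂'
  rw [TTy.wk_up1, TTy.wk_up1] at h₂'
  refine h₁'.cpsApp_pure (Nat.succ_pos _) (.var_of_lookup hΔ ?_) (.lam ?_)
  · simp [TCtx.lookup, TTy.ren_ren]; rfl
  · refine h₂'.cpsApp_pure (Nat.succ_pos _) (.var_of_lookup hΔ' ?_) (.var_of_lookup hΔ' ?_)
    · simp [TCtx.lookup, TTy.ren_ren]
    · simp [TCtx.lookup, TTy.ren_ren, TTy.ren]

/-- The answer types compose through `σ`: it is what `c₂` yields when run with `h` and `k`, and what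
`c₁` expects of its continuation. The final answer is then `σ₁₂`. -/
theorem TTyped.letI {Γ : TCtx P} {ς τ₁ τ₂ σ σ₁₂ σ₂₁ : TTy P} {c₁ c₂ : TExp P}
    (h₁ : TTyped K Γ c₁ (.cpsImp ς τ₁ σ σ₁₂))
    (h₂ : TTyped K (.var τ₁ :: Γ) c₂
      (.cpsImp ς.wk τ₂.wk (σ₂₁.ren (liftR 1 (· + 1)) id id) σ)) :
    TTyped K Γ (cpsAbs (ς.ren id id (· + 1)) ((TTy.arr τ₂ σ₂₁).ren (· + 1) id (· + 1))
      (cpsApp c₁.up σ₁₂.up (.var 1)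
        (.lam .dy τ₁.up (cpsApp c₂.up1 σ.up1 (.var 2) (.var 1))))) (.cpsImp ς τ₂ σ₂₁ σ₁₂) := by
  have hw₁ := TTy.cpsImp_wf.1 h₁.wf
  have hw₂ := TTy.WF.of_wk (τ := .arr τ₂ σ₂₁) (TTy.cpsImp_wf.1 h₂.wf).2.1
  have hw : (TTy.cpsImp ς τ₂ σ₂₁ σ₁₂).WF Γ := TTy.cpsImp_wf.2 ⟨hw₁.1, hw₂, hw₁.2.2⟩
  have wk := TCtx.Wk.up Γ (ς.ren id id (· + 1)) ((TTy.arr τ₂ σ₂₁).ren (· + 1) id (· + 1))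
  have hΔ : TCtx.WF (.var ((TTy.arr τ₂ σ₂₁).ren (· + 1) id (· + 1)) ::
      .var (ς.ren id id (· + 1)) :: .ty :: Γ) := ⟨⟨h₁.ctx_wf, hw.1⟩, hw.2.1⟩
  have hΔ' : TCtx.WF (.var τ₁.up :: .var ((TTy.arr τ₂ σ₂₁).ren (· + 1) id (· + 1)) ::
      .var (ς.ren id id (· + 1)) :: .ty :: Γ) := ⟨hΔ, hw₁.2.1.1.ren wk.toRen⟩
  refine .cpsAbs_imp ?_
  have h₁' := h₁.ren wk hΔ
  have h₂' := h₂.ren (wk.var τ₁) hΔ'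
  rw [TTy.cpsImp_ren] at h₁' h₂'
  rw [TTy.wk_up1, TTy.wk_up1] at h₂'
  refine h₁'.cpsApp_imp (hw₁.2.2.ren wk.toRen) (.var_of_lookup hΔ ?_) (.lam ?_)
  · simp [TCtx.lookup, TTy.ren_ren]; rfl
  · refine h₂'.cpsApp_imp (hw₁.2.1.2.ren (wk.var τ₁).toRen) (.var_of_lookup hΔ' ?_)
      (.var_of_lookup hΔ' ?_)
    · simp [TCtx.lookup, TTy.ren_ren]
    · simp [TCtx.lookup, TTy.ren_ren, TTy.ren, liftR_comp]

theorem TTyped.op {Γ : TCtx P} {D : Finset P.Op} {G : {o // o ∈ D} → TTy P} {o : P.Op}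
    {As : List (Pred P)} {v : TVal P} {Bs : List (List P.Base)} {τ₁ τ₂ σ₁ σ₂ τ σ₁' σ₂' : TTy P}
    (ho : o ∈ D) (hG : G ⟨o, ho⟩ = .allP Bs (.arr τ₁ (.arr (.arr τ₂ σ₁) σ₂.wk)))
    (hwf : (TTy.rcd D G).WF Γ) (hA : List.Forall₂ Γ.PredWF As Bs)
    (hv : TVTyped K Γ v (τ₁.subst .var (instP As) .tvar))
    (hτ : τ = τ₂.subst (inst v.tm) (instP As) .tvar)
    (hσ₁ : σ₁' = σ₁.subst (liftT 1 (inst v.tm)) (liftP 1 0 (instP As)) .tvar)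
    (hσ₂ : σ₂' = σ₂.subst (inst v.tm) (instP As) .tvar) :
    TTyped K Γ (cpsAbs ((TTy.rcd D G).ren id id (· + 1)) ((TTy.arr τ σ₁').ren (· + 1) id (· + 1))
      (.app .dy (.app .dy (.papp (.proj (.var 1) o) (As.map (Pred.ren (· + 2) id))) v.up)
        (.lam .dy τ.up (.app .dy (.val (.var 1)) (.var 0))))) (.cpsImp (.rcd D G) τ σ₁' σ₂') := by
  -- What is left of the handler entry's type after its predicate and value arguments: a function
  -- from continuations to answers. It yields both the well-formedness of the instantiated types and
  -- the type of the inner application.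
  have he : ((TTy.arr (.arr τ₂ σ₁) σ₂.wk).subst (inst v.tm) (instP As) .tvar) =
      .arr (.arr τ σ₁') σ₂'.wk := by
    subst hτ hσ₁ hσ₂
    simp only [TTy.subst, liftY_tvar, TTy.ren_subst, TTy.subst_ren, liftT_one_succ,
      liftP_one_apply, TTy.ren]
    rfl
  have hbody : (TTy.arr (.arr τ σ₁') σ₂'.wk).WF Γ := by
    have h := hwf ⟨o, ho⟩
    rw [hG] at h
    rw [← he]
    exact TTy.WF.subst (τ := .arr (.arr τ₂ σ₁) σ₂.wk) h.2
      ((TCtx.sub_instP hA).trans_inst fun b hb => hv.tm_hasSort b (TTy.sort_subst hb))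
  have hw : (TTy.cpsImp (.rcd D G) τ σ₁' σ₂').WF Γ :=
    TTy.cpsImp_wf.2 ⟨hwf, hbody.1, hbody.2.of_wk⟩
  have wk := TCtx.Wk.up Γ ((TTy.rcd D G).ren id id (· + 1))
    ((TTy.arr τ σ₁').ren (· + 1) id (· + 1))
  have hΔ : TCtx.WF (.var ((TTy.arr τ σ₁').ren (· + 1) id (· + 1)) ::
      .var ((TTy.rcd D G).ren id id (· + 1)) :: .ty :: Γ) := ⟨⟨hv.ctx_wf, hw.1⟩, hw.2.1⟩
  have hΔ' : TCtx.WF (.var τ.up :: .var ((TTy.arr τ σ₁').ren (· + 1) id (· + 1)) ::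
      .var ((TTy.rcd D G).ren id id (· + 1)) :: .ty :: Γ) := ⟨hΔ, hbody.1.1.ren wk.toRen⟩
  refine .cpsAbs_imp ?_
  have hh : TVTyped K _ (.var 1) (.rcd D fun o => (G o).up) :=
    .var_of_lookup hΔ (by simp [TCtx.lookup, TTy.ren_ren, TTy.ren]; rfl)
  have hproj := TTyped.proj ho hh
  rw [hG] at hproj
  have hpapp := TTyped.papp hproj (TCtx.forall₂_predWF_map wk.toRen hA)
  -- The weakening past `α`, `h` and `k` is moved outside each instantiation, so that `he` applies
  -- to the unweakened type.
  rw [← hA.length_eq, ← TTy.subst_instP_ren] at hpapp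
  have happ := TTyped.app (m := .dy) hpapp (hv.ren wk hΔ)
  rw [TVal.tm_ren, ← TTy.subst_inst_ren, liftT_var, liftY_tvar, TTy.subst_liftP_subst_inst,
    he] at happ
  have hlam : TVTyped K (.var ((TTy.arr τ σ₁').ren (· + 1) id (· + 1)) ::
      .var ((TTy.rcd D G).ren id id (· + 1)) :: .ty :: Γ)
      (.lam .dy τ.up (.app .dy (.val (.var 1)) (.var 0))) (TTy.arr τ σ₁').up := by
    -- The shift is `3` because the type of `k` has passed `h`, `k` and `y'`. Applying `k` to `y'`
    -- identifies the bound variable of its codomain with `y'`, leaving a shift of `2` under one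
    -- binder.
    have hk : TVTyped K _ (.var 1) (.arr τ.up.wk (σ₁'.ren (liftR 1 (· + 3)) id (· + 1))) :=
      .var_of_lookup hΔ' (by simp [TCtx.lookup, TTy.ren_ren, TTy.ren, liftR_comp]; rfl)
    have hy : TVTyped K _ (.var 0) τ.up.wk :=
      .var_of_lookup hΔ' (by simp [TCtx.lookup])
    have := TTyped.app (m := .dy) (.val hk) hy
    rw [TTy.ren_subst_inst (r' := liftR 1 (· + 2)) fun i => by cases i <;> simp [TVal.tm]] at this
    exact .lam this
  have := TTyped.app (m := .dy) happ hlam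
  rwa [TTy.up_subst_inst] at this

/-! ### The transformation preserves typing -/

theorem OSig.cps_empty (F : {o // o ∈ (∅ : Finset P.Op)} → Scheme P) :
    (OSig.mk ∅ F).cps.ren id id (· + 1) =
      .rcd ∅ (fun o => absurd o.2 (Finset.notMem_empty _)) := by
  simp only [OSig.cps, TTy.ren]
  congr 1
  funext o
  exact absurd o.2 (Finset.notMem_empty _)

theorem Ctx.WF.cps : ∀ {Γ : Ctx P}, Γ.WF → Γ.cps.WF
  | [], _ => trivial
  | .var _ :: _, h => ⟨WF.cps h.1, h.2.cps⟩
  | .pred _ :: Γ, h => WF.cps (Γ := Γ) h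
  | .hyp _ :: _, h => ⟨WF.cps h.1, Ctx.fmlWF_cps.2 h.2⟩

mutual
theorem VTyped.cps : ∀ {Γ : Ctx P} {v : Val P} {T : VTy P}, VTyped K Γ v T →
    TVTyped K Γ.cps v.cps T.cps
  | _, _, _, .cvar hΓ hx => .cvar hΓ.cps (Ctx.lookup_cps hx)
  | _, _, _, .var hΓ hx hT => .var hΓ.cps (Ctx.lookup_cps hx) (VTy.cps_ne_rfn hT)
  | _, _, _, .prim hΓ => .prim hΓ.cps
  | _, _, _, @VTyped.fix _ _ Γ T C c h => by
    have h' : TTyped K (.var T.wk.cps :: .var (.arr T.cps C.cps) :: Ctx.cps Γ) _ _ := h.cps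
    rw [← VTy.cps_ren _ _ id, ← CTy.cps_ren _ _ id] at h'
    exact .fix h'
  -- The smaller type is not assumed well-formed in the source; its transform is, by regularity of
  -- the transformed premise.
  | _, _, _, .sub h hs hT => .sub h.cps (hs.cps h.cps.wf hT.cps) hT.cps
theorem CTyped.cps : ∀ {Γ : Ctx P} {c : Cmp P} {C : CTy P}, CTyped K Γ c C →
    TTyped K Γ.cps c.cps C.cps
  | _, _, _, @CTyped.ret _ _ Γ v T h => by
    rw [Cmp.cps, CTy.cps_pure, ← OSig.cps_empty]
    have h' := h.cps
    have hw : (TTy.cpsPure (OSig.mk ∅ fun o => absurd o.2 (Finset.notMem_empty _)).cps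
        T.cps).WF Γ.cps :=
      TTy.cpsPure_wf.2 ⟨fun o => absurd o.2 (Finset.notMem_empty _), h'.wf⟩
    have hΔ : TCtx.WF (.var (.arr (T.cps.ren (· + 1) id (· + 1)) (.tvar 0)) ::
        .var ((OSig.mk ∅ fun o => absurd o.2 (Finset.notMem_empty _)).cps.ren id id (· + 1)) ::
        .ty :: Γ.cps) := ⟨⟨h'.ctx_wf, hw.1⟩, hw.2.1⟩
    refine .cpsAbs_pure (.app (τ₂ := .tvar 0) (.val (.var_of_lookup hΔ ?_))
      (h'.ren (TCtx.Wk.up _ _ _) hΔ))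
    simp [TCtx.lookup, TTy.ren_ren, TTy.ren]
    rfl
  | _, _, _, @CTyped.app _ _ Γ v₁ v₂ T C h₁ h₂ => by
    rw [← CTy.cps_subst _ _ .tvar, ← Val.tm_cps]
    exact .app (.val h₁.cps) h₂.cps
  | _, _, _, .ite h h₁ h₂ => by
    have h₁' := h₁.cps
    have h₂' := h₂.cps
    rw [← Val.tm_cps] at h₁' h₂'
    exact .asc (.ite h.cps h₁' h₂')
  | _, _, _, .sub h hs hC => .sub h.cps (hs.cps h.cps.wf hC.cps) hC.cps
  | _, _, _, .letP h₁ h₂ => by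
    have h₁' := h₁.cps
    have h₂' := h₂.cps
    rw [CTy.cps_pure] at h₁' h₂'
    rw [← VTy.cps_ren _ _ id, ← OSig.cps_ren _ _ id] at h₂'
    rw [Cmp.cps, CTy.cps_pure]
    exact .letP h₁' h₂'
  | _, _, _, .letI h₁ h₂ => by
    have h₁' := h₁.cps
    have h₂' := h₂.cps
    rw [CTy.cps_imp] at h₁' h₂'
    rw [← VTy.cps_ren _ _ id, ← OSig.cps_ren _ _ id, ← CTy.cps_ren _ _ id] at h₂'
    rw [Cmp.cps, CTy.cps_imp]
    exact .letI h₁' h₂'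
  | _, _, _, @CTyped.op _ _ Γ D F o As v Bs T₁ T₂ C₁ C₂ T C₁' C₂' ho hF hwf hA hv hT hC => by
    rw [Cmp.cps, CTy.cps_imp, OSig.cps]
    have hv' := hv.cps
    rw [← VTy.cps_subst _ _ .tvar] at hv'
    rw [← Ctx.predWF_cps] at hA
    simp only [Eff.subst, Eff.imp.injEq] at hC
    exact TTyped.op (τ₁ := T₁.cps) (τ₂ := T₂.cps) (σ₁ := C₁.cps) (σ₂ := C₂.cps) ho
      (by rw [hF, Scheme.cps]) hwf.cps hA hv' (by rw [hT, VTy.cps_subst, Val.tm_cps])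
      (by rw [hC.1, CTy.cps_subst, Val.tm_cps]) (by rw [hC.2, CTy.cps_subst, Val.tm_cps])
  | _, _, _, @CTyped.handle _ _ Γ c T C₁ C₂ cr D Bs Tx T₂ D₁ D₂ cl hc hr hcl => by
    have hc' := hc.cps
    have hr' := hr.cps
    rw [CTy.cps_imp] at hc'
    -- The type argument `⟦C₂⟧` is a component of the type of `⟦c⟧`, so its well-formedness follows
    -- from regularity.
    refine hc'.cpsApp_imp (TTy.cpsImp_wf.1 hc'.wf).2.2 (.rcd hc'.ctx_wf fun o => ?_) (.lam hr')
    have h := (hcl o).cps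
    -- The source weakens the type of a clause body past `k`; as a weakened transform it is the
    -- codomain that `Scheme.cps` prescribes.
    rw [← CTy.cps_ren _ _ id] at h
    change TTyped K (.var (.arr (T₂ o).cps (D₁ o).cps) :: .var (Tx o).cps ::
      (Γ.addP (Bs o)).cps) _ _ at h
    rw [Ctx.cps_addP] at h
    exact .plam (.val (.lam (.val (.lam h))))
end

end ARM
theorem theorem3 (P : ARM.Params.{u}) (K : ARM.PrimTyping P) :
    (∀ (Γ : ARM.Ctx P) (v : ARM.Val P) (T : ARM.VTy P),
      ARM.VTyped K Γ v T → ARM.TVTyped K Γ.cps v.cps T.cps) ∧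
    (∀ (Γ : ARM.Ctx P) (c : ARM.Cmp P) (C : ARM.CTy P),
      ARM.CTyped K Γ c C → ARM.TTyped K Γ.cps c.cps C.cps) :=
  ⟨fun _ _ _ h => h.cps, fun _ _ _ h => h.cps⟩
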